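/- Let $X$ be a set with at least two points and let $\rho:X\times X\to[0,\infty)$ be a quasi-metric: $\rho(x,y)=0$ iff $x=y$, and there are constants $C_0,C_1>0$ with $\rho(y,x)\le C_0\,\rho(x,y)$ and $\rho(x,y)\le C_1\max\{\rho(x,z),\rho(z,y)\}$ for all $x,y,z\in X$. Let $$C_\rho:=\sup\frac{\rho(x,y)}{\max\{\rho(x,z),\rho(z,y)\}},$$ the supremum being taken over all $x,y,z\in X$ that are not all equal, and put $B_\rho(x,r):=\{y\in X:\rho(x,y)<r\}$. Let $\mu$ be a Borel measure on $(X,\rho)$ such that every ball $B_\rho(x,r)$, $x\in X$, $r\in(0,\infty)$, is $\mu$-measurable with $\mu(B_\rho(x,r))\in(0,\infty)$. For $A\subset X$ measurable, $s,p\in(0,\infty)$, $q\in(0,\infty]$ and a measurable $u:A\to\mathbb R$, a fractional $s$-gradient of $u$ on $A$ is a sequence $\vec g=(g_k)_{k\in\mathbb Z}$ of nonnegative measurable functions on $A$ for which there is $E\subset A$ with $\mu(E)=0$ and $$|u(x)-u(y)|\le\rho(x,y)^s\,[g_k(x)+g_k(y)]$$ for all $k\in\mathbb Z$ and $x,y\in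 A\setminus E$ with $2^{-k-1}\le\rho(x,y)<2^{-k}$. The space $\dot N^s_{p,q}(A)$ consists of all measurable $u:A\to\mathbb R$ with $$\|u\|_{\dot N^s_{p,q}(A)}:=\inf_{\vec g}\Big\|\big(\|g_k\|_{L^p(A,\mu)}\big)_{k\in\mathbb Z}\Big\|_{\ell^q(\mathbb Z)}<\infty,$$ the infimum being taken over all fractional $s$-gradients of $u$ on $A$ (with $\inf\emptyset=\infty$). **Theorem.** Let $s,p\in(0,\infty)$, $q\in(0,\infty]$, $\sigma\in[C_\rho,\infty)$ and $\varepsilon\in(0,s)$. Let $B_0=B_\rho(x_0,R_0)$ with $x_0\in X$, $R_0\in(0,\infty)$, put $\sigma B_0:=B_\rho(x_0,\sigma R_0)$, and assume that for some $Q,b\in(0,\infty)$ the measure satisfies the condition $V(\sigma B_0,Q,b)$: $$\mu(B_\rho(x,r))\ge b\,r^Q\quad\text{for all }x\in X,\ r\in(0,\sigma R_0]\text{ with }B_\rho(x,r)\subset\sigma B_0.$$ Then there exist positive constants $C,C_1,C_2$, depending only on $\rho,s,\varepsilon,p,\sigma$ (so not on $\mu,q,Q,b,B_0,u$), such that the following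 holds for every $u\in\dot N^s_{p,q}(\sigma B_0)$, where $⨍_{B}:=\frac1{\mu(B)}\int_B$ and $u_{B_0}:=⨍_{B_0}u\,d\mu$. (a) If $p<Q/\varepsilon$ and $p^*:=Qp/(Q-\varepsilon p)$, then $u\in L^{p^*}(B_0)$, $$\Big(⨍_{B_0}|u|^{p^*}d\mu\Big)^{1/p^*}\le C\,b^{-1/p}R_0^{-Q/p}\Big[R_0^s\,\|u\|_{\dot N^s_{p,q}(\sigma B_0)}+\|u\|_{L^p(\sigma B_0)}\Big]$$ and $$\inf_{\gamma\in\mathbb R}\Big(⨍_{B_0}|u-\gamma|^{p^*}d\mu\Big)^{1/p^*}\le C\,b^{-1/p}R_0^{s-Q/p}\,\|u\|_{\dot N^s_{p,q}(\sigma B_0)}.$$ (b) If $p=Q/\varepsilon$ and $\|u\|_{\dot N^s_{p,q}(\sigma B_0)}>0$, then $u\in L^1(B_0)$ and $$⨍_{B_0}\exp\Big(C_1\,b^{1/p}\,\frac{|u-u_{B_0}|}{R_0^{s-\varepsilon}\,\|u\|_{\dot N^s_{p,q}(\sigma B_0)}}\Big)\,d\mu\le C_2.$$ (c) If $p>Q/\varepsilon$,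 then $u\in L^1(B_0)$ and $$\|u-u_{B_0}\|_{L^\infty(B_0)}\le C\,b^{-1/p}R_0^{s-Q/p}\,\|u\|_{\dot N^s_{p,q}(\sigma B_0)},$$ and $u$ coincides $\mu$-almost everywhere on $B_0$ with a function $v$ that is Hölder continuous of order $s-Q/p$ on $B_0$, with $$|v(x)-v(y)|\le C\,b^{-1/p}\,\rho(x,y)^{s-Q/p}\,\|u\|_{\dot N^s_{p,q}(\sigma B_0)}\quad\text{for all }x,y\in B_0.$$ -/

import Mathlib

open MeasureTheory Set
open scoped ENNReal NNReal

namespace HajlaszBesov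

/-- A quasi-metric on `X`: nonnegative, nondegenerate, quasi-symmetric and quasi-subadditive.
It need not be symmetric. -/
structure IsQuasiMetric {X : Type*} (ρ : X → X → ℝ) : Prop where
  nonneg : ∀ x y, 0 ≤ ρ x y
  eq_zero_iff : ∀ x y, ρ x y = 0 ↔ x = y
  quasi_symm : ∃ C₀ : ℝ, 0 < C₀ ∧ ∀ x y, ρ y x ≤ C₀ * ρ x y
  quasi_subadd : ∃ C₁ : ℝ, 0 < C₁ ∧ ∀ x y z, ρ x y ≤ C₁ * max (ρ x z) (ρ z y)

/-- The `ρ`-ball `B_ρ(x, r) = {y : ρ(x, y) < r}`. -/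
def qball {X : Type*} (ρ : X → X → ℝ) (x : X) (r : ℝ) : Set X := {y | ρ x y < r}

/-- The constant `C_ρ`: the supremum of `ρ(x,y) / max{ρ(x,z), ρ(z,y)}` over all triples of points
that are not all equal. -/
noncomputable def quasiConst {X : Type*} (ρ : X → X → ℝ) : ℝ :=
  sSup {c : ℝ | ∃ x y z : X, ¬ (x = y ∧ y = z) ∧ c = ρ x y / max (ρ x z) (ρ z y)}

/-- The topology `τ_ρ`: a set is open iff it contains a `ρ`-ball around each of its points. -/
@[reducible] def quasiTopology {X : Type*} (ρ : X → X → ℝ) : TopologicalSpace X where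
  IsOpen O := ∀ x ∈ O, ∃ r : ℝ, 0 < r ∧ qball ρ x r ⊆ O
  isOpen_univ := fun _ _ => ⟨1, one_pos, subset_univ _⟩
  isOpen_inter := by
    intro s t hs ht x hx
    obtain ⟨r₁, h₁, hr₁⟩ := hs x hx.1
    obtain ⟨r₂, h₂, hr₂⟩ := ht x hx.2
    refine ⟨min r₁ r₂, lt_min h₁ h₂, fun y hy => ⟨hr₁ ?_, hr₂ ?_⟩⟩
    · exact lt_of_lt_of_le (show ρ x y < min r₁ r₂ from hy) (min_le_left _ _)
    · exact lt_of_lt_of_le (show ρ x y < min r₁ r₂ from hy) (min_le_right _ _)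
  isOpen_sUnion := by
    intro S hS x hx
    obtain ⟨t, ht, hxt⟩ := hx
    obtain ⟨r, hr, hrt⟩ := hS t ht x hxt
    exact ⟨r, hr, hrt.trans (subset_sUnion_of_mem ht)⟩

/-- `μ` is a Borel measure on `(X, ρ)` (it is defined on a σ-algebra containing the Borel sets of
`τ_ρ`), all `ρ`-balls are `μ`-measurable, that is, measurable for the completion of `μ`, and they
have positive and finite measure. -/
structure IsBallMeasure {X : Type*} [MeasurableSpace X] (ρ : X → X → ℝ) (μ : Measure X) :
    Prop where
  borel_le : @borel X (quasiTopology ρ) ≤ ‹MeasurableSpace X›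
  nullMeasurable_ball : ∀ (x : X) (r : ℝ), 0 < r → NullMeasurableSet (qball ρ x r) μ
  ball_pos : ∀ (x : X) (r : ℝ), 0 < r → 0 < μ (qball ρ x r)
  ball_lt_top : ∀ (x : X) (r : ℝ), 0 < r → μ (qball ρ x r) < ∞

/-- The `V(σB₀, Q, b)` condition for the ball `B₀ = B_ρ(x₀, R₀)`. -/
def VCondition {X : Type*} [MeasurableSpace X] (ρ : X → X → ℝ) (μ : Measure X)
    (x₀ : X) (R₀ σ Q b : ℝ) : Prop :=
  ∀ (x : X) (r : ℝ), 0 < r → r ≤ σ * R₀ → qball ρ x r ⊆ qball ρ x₀ (σ * R₀) →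
    ENNReal.ofReal (b * r ^ Q) ≤ μ (qball ρ x r)

/-- `g = (g_k)_{k ∈ ℤ}` is a fractional `s`-gradient of `u` on the quasi-metric measure space
`(A, ρ, μ)`, for `A ⊆ X`. Only the values of `u` and of the `g_k` on `A` matter. -/
def IsFracGradient {X : Type*} [MeasurableSpace X] (ρ : X → X → ℝ) (μ : Measure X) (A : Set X)
    (s : ℝ) (u : X → ℝ) (g : ℤ → X → ℝ≥0) : Prop :=
  (∀ k, AEMeasurable (g k) (μ.restrict A)) ∧
  ∃ E : Set X, E ⊆ A ∧ μ E = 0 ∧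
    ∀ k : ℤ, ∀ x ∈ A \ E, ∀ y ∈ A \ E,
      (2 : ℝ) ^ (-k - 1) ≤ ρ x y → ρ x y < (2 : ℝ) ^ (-k) →
        |u x - u y| ≤ ρ x y ^ s * (g k x + g k y)

/-- The `ℓ^q(ℤ)` (quasi-)norm of a sequence in `[0, ∞]`, for `q ∈ (0, ∞]`. -/
noncomputable def ellNorm (q : ℝ≥0∞) (a : ℤ → ℝ≥0∞) : ℝ≥0∞ :=
  if q = ∞ then ⨆ k, a k else (∑' k, a k ^ q.toReal) ^ (1 / q.toReal)

/-- The homogeneous Hajłasz–Besov seminorm `‖u‖` of `Ṅ^s_{p,q}(A, ρ, μ)`: the infimum of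
`‖g‖_{ℓ^q(L^p(A))}` over all fractional `s`-gradients `g` of `u` on `A` (`∞` if there are none). -/
noncomputable def besovSeminorm {X : Type*} [MeasurableSpace X] (ρ : X → X → ℝ) (μ : Measure X)
    (A : Set X) (s p : ℝ) (q : ℝ≥0∞) (u : X → ℝ) : ℝ≥0∞ :=
  ⨅ (g : ℤ → X → ℝ≥0) (_ : IsFracGradient ρ μ A s u g),
    ellNorm q (fun k => eLpNorm (fun x => (g k x : ℝ)) (ENNReal.ofReal p) (μ.restrict A))

/-- `u` (restricted to `A`) belongs to the homogeneous Hajłasz–Besov space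
`Ṅ^s_{p,q}(A, ρ, μ)`. -/
def MemBesov {X : Type*} [MeasurableSpace X] (ρ : X → X → ℝ) (μ : Measure X)
    (A : Set X) (s p : ℝ) (q : ℝ≥0∞) (u : X → ℝ) : Prop :=
  AEMeasurable u (μ.restrict A) ∧ besovSeminorm ρ μ A s p q u < ∞

end HajlaszBesov

namespace HajlaszBesov

variable {X : Type*}

/-! ### Quasi-metrics -/

/-! Of the `ℓ^q` norm only a common bound `M` for all `‖g_k‖_{L^p}` is used, so `q` plays no role.
For `0 ≤ τ < s` put `G_k = (∑_{i ≥ k} (2^{-i(s-τ)} g_i)^p)^{1/p}`. A geometric series gives `‖G_k‖_p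
≲ 2^{-k(s-τ)} M`, and off a null set `|u(x) - u(y)| ≤ ρ(x,y)^τ (G_k(x) + G_k(y))` whenever `ρ(x,y) <
2^{-k}` (`ofReal_abs_sub_le_tailGrad`). By Markov's inequality and the lower measure bound, each
ball of radius `r ≤ R₀` centred in `B₀` contains a good point, where `G_k ≲ 2^{-k(s-τ)} M (b
r^Q)^{-1/p}` (`exists_tailGrad_le`).

If `Q/p < s`, take `τ = 0` and good points `y_n ∈ B(x, 2^{-n} R₀)`, with the level of the tail
growing with `n`. The values `u(y_n)` have increments of order `(2^{-n} R₀)^{s-Q/p}`, and their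
limit is the Hölder representative (`exists_holder`).

If `Q/p > ε`, take `τ = ε` and one fixed level. A Hedberg-type argument chooses the radius at which
the good-point bound equals `G(x)`, then chains through doubled balls up to scale `R₀`. This bounds
`|u(x) - u(z)|^{p*}` by a multiple of `1 + t^{-p} G(x)^p`, with `t` the good-point bound at scale
`R₀`, and the right side is integrable (`abs_sub_rpow_le`).

The constants may not depend on `Q`, but the first one degenerates as `Q/p → s` and the second as
`Q/p → ε`. Since `ε < s` the two ranges overlap, and switching at `Q/p = (s+ε)/2` keeps both
uniform. Parts (b) and (c) have `Q/p ≤ ε`, so they follow from the Hölder estimate alone. In (b) the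
oscillation is even bounded. -/

theorem IsQuasiMetric.self_eq_zero {ρ : X → X → ℝ} (hρ : IsQuasiMetric ρ) (x : X) : ρ x x = 0 :=
  (hρ.eq_zero_iff x x).2 rfl

theorem IsQuasiMetric.pos {ρ : X → X → ℝ} (hρ : IsQuasiMetric ρ) {x y : X} (h : x ≠ y) :
    0 < ρ x y :=
  lt_of_le_of_ne (hρ.nonneg x y) fun h0 => h ((hρ.eq_zero_iff x y).1 h0.symm)

theorem IsQuasiMetric.bddAbove_ratio {ρ : X → X → ℝ} (hρ : IsQuasiMetric ρ) :
    BddAbove {c : ℝ | ∃ x y z : X, ¬ (x = y ∧ y = z) ∧ c = ρ x y / max (ρ x z) (ρ z y)} := by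
  obtain ⟨C₁, h₁, h⟩ := hρ.quasi_subadd
  refine ⟨C₁, ?_⟩
  rintro c ⟨x, y, z, -, rfl⟩
  exact div_le_of_le_mul₀ (le_max_of_le_left (hρ.nonneg _ _)) h₁.le (h x y z)

theorem IsQuasiMetric.le_quasiConst_mul {ρ : X → X → ℝ} (hρ : IsQuasiMetric ρ) (x y z : X) :
    ρ x y ≤ quasiConst ρ * max (ρ x z) (ρ z y) := by
  by_cases hxyz : x = y ∧ y = z
  · obtain ⟨rfl, rfl⟩ := hxyz
    simp [hρ.self_eq_zero]
  · have hpos : 0 < max (ρ x z) (ρ z y) := by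
      by_cases hxz : x = z
      · subst hxz
        exact lt_max_of_lt_right (hρ.pos fun h => hxyz ⟨h, h.symm⟩)
      · exact lt_max_of_lt_left (hρ.pos hxz)
    rw [← div_le_iff₀ hpos]
    exact le_csSup hρ.bddAbove_ratio ⟨x, y, z, hxyz, rfl⟩

theorem IsQuasiMetric.one_le_quasiConst [Nontrivial X] {ρ : X → X → ℝ} (hρ : IsQuasiMetric ρ) :
    1 ≤ quasiConst ρ := by
  obtain ⟨x, y, hxy⟩ := exists_pair_ne X
  have h := hρ.le_quasiConst_mul x y x
  have hp := hρ.pos hxy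
  rw [hρ.self_eq_zero, max_eq_right hp.le] at h
  exact le_of_mul_le_mul_right (by linarith) hp

/-- `κ` controls both the quasi-symmetry and the quasi-subadditivity of `ρ`. -/
structure IsQuasiBound (ρ : X → X → ℝ) (κ : ℝ) : Prop where
  one_le : 1 ≤ κ
  nonneg : ∀ x y, 0 ≤ ρ x y
  symm : ∀ x y, ρ y x ≤ κ * ρ x y
  subadd : ∀ x y z, ρ x y ≤ κ * max (ρ x z) (ρ z y)

theorem IsQuasiMetric.exists_isQuasiBound [Nontrivial X] {ρ : X → X → ℝ}
    (hρ : IsQuasiMetric ρ) : ∃ κ, IsQuasiBound ρ κ := by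
  obtain ⟨C₀, -, h⟩ := hρ.quasi_symm
  refine ⟨max C₀ (quasiConst ρ), le_max_of_le_right hρ.one_le_quasiConst, hρ.nonneg,
    fun x y => ?_, fun x y z => ?_⟩
  · exact (h x y).trans (mul_le_mul_of_nonneg_right (le_max_left _ _) (hρ.nonneg _ _))
  · exact (hρ.le_quasiConst_mul x y z).trans
      (mul_le_mul_of_nonneg_right (le_max_right _ _) (le_max_of_le_left (hρ.nonneg _ _)))

theorem IsQuasiBound.lt_of_lt {ρ : X → X → ℝ} {κ : ℝ} (h : IsQuasiBound ρ κ) {x y z : X} {r : ℝ}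
    (h₁ : ρ x z < r) (h₂ : ρ z y < r) : ρ x y < κ * r :=
  (h.subadd x y z).trans_lt (mul_lt_mul_of_pos_left (max_lt h₁ h₂) (by linarith [h.one_le]))

theorem IsQuasiBound.symm_lt {ρ : X → X → ℝ} {κ : ℝ} (h : IsQuasiBound ρ κ) {x y : X} {r : ℝ}
    (h₁ : ρ x y < r) : ρ y x < κ * r :=
  (h.symm x y).trans_lt (mul_lt_mul_of_pos_left h₁ (by linarith [h.one_le]))

/-- Two points of a common ball of radius `r` are at distance less than `κ ^ 2 * r`. -/
theorem IsQuasiBound.lt_of_mem_qball {ρ : X → X → ℝ} {κ : ℝ} (h : IsQuasiBound ρ κ)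
    {x y z : X} {r : ℝ} (hy : y ∈ qball ρ x r) (hz : z ∈ qball ρ x r) : ρ y z < κ ^ 2 * r := by
  have hr : 0 < r := (h.nonneg _ _).trans_lt hy
  have := h.lt_of_lt (h.symm_lt hy) (lt_of_lt_of_le hz (le_mul_of_one_le_left hr.le h.one_le))
  calc ρ y z < _ := this
    _ = _ := by ring

/-- This is what `σ ≥ C_ρ` is for: the measure condition becomes available for all balls of radius
at most `R₀` centred in `B₀`. -/
theorem qball_subset_qball_of_mem {ρ : X → X → ℝ} (hρ : IsQuasiMetric ρ) {σ R₀ r : ℝ}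
    (h4 : 1 ≤ quasiConst ρ) (hσ : quasiConst ρ ≤ σ) {x₀ x : X} (hx : x ∈ qball ρ x₀ R₀) (hr : r ≤ R₀) :
    qball ρ x r ⊆ qball ρ x₀ (σ * R₀) := by
  intro y hy
  have hR : 0 < R₀ := (hρ.nonneg _ _).trans_lt hx
  have h1 : ρ x₀ x < R₀ := hx
  have h2 : ρ x y < r := hy
  calc ρ x₀ y ≤ _ := hρ.le_quasiConst_mul x₀ y x
    _ < quasiConst ρ * R₀ :=
        mul_lt_mul_of_pos_left (max_lt h1 (h2.trans_le hr)) (by linarith)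
    _ ≤ σ * R₀ := mul_le_mul_of_nonneg_right hσ hR.le

/-! ### Tails of fractional gradients -/

/-- The `ℓ^p`-sum of the functions `2 ^ (-i * a) * g_i` over `i ≥ k`. -/
noncomputable def tailGrad (p a : ℝ) (g : ℤ → X → ℝ≥0) (k : ℤ) (x : X) : ℝ≥0∞ :=
  (∑' n : ℕ, (ENNReal.ofReal ((2 : ℝ) ^ (-((k + n : ℤ) : ℝ) * a)) * (g (k + n) x : ℝ≥0∞)) ^ p)
    ^ (1 / p)

theorem le_tailGrad {p : ℝ} (hp : 0 < p) (a : ℝ) (g : ℤ → X → ℝ≥0) {k i : ℤ} (hki : k ≤ i)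
    (x : X) : ENNReal.ofReal ((2 : ℝ) ^ (-(i : ℝ) * a)) * (g i x : ℝ≥0∞) ≤ tailGrad p a g k x := by
  obtain ⟨n, rfl⟩ := Int.le.dest hki
  rw [tailGrad, one_div, ENNReal.le_rpow_inv_iff hp]
  exact ENNReal.le_tsum (f := fun n : ℕ =>
    (ENNReal.ofReal ((2 : ℝ) ^ (-((k + n : ℤ) : ℝ) * a)) * (g (k + n) x : ℝ≥0∞)) ^ p) n

theorem tailGrad_rpow {p : ℝ} (hp : 0 < p) (a : ℝ) (g : ℤ → X → ℝ≥0) (k : ℤ) (x : X) :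
    tailGrad p a g k x ^ p = ∑' n : ℕ,
      (ENNReal.ofReal ((2 : ℝ) ^ (-((k + n : ℤ) : ℝ) * a)) * (g (k + n) x : ℝ≥0∞)) ^ p := by
  rw [tailGrad, one_div, ENNReal.rpow_inv_rpow hp.ne']

theorem tailGrad_add_rpow {p : ℝ} (hp : 0 < p) (a : ℝ) (g : ℤ → X → ℝ≥0) (k : ℤ) (m : ℕ) (x : X) :
    tailGrad p a g (k + m) x ^ p = ∑' n : ℕ, (ENNReal.ofReal
      ((2 : ℝ) ^ (-((k + (n + m : ℕ) : ℤ) : ℝ) * a)) * (g (k + (n + m : ℕ)) x : ℝ≥0∞)) ^ p := by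
  rw [tailGrad_rpow hp]
  refine tsum_congr fun n => ?_
  have : k + (m : ℤ) + n = k + (n + m : ℕ) := by push_cast; ring
  rw [this]

theorem tailGrad_antitone {p : ℝ} (hp : 0 < p) (a : ℝ) (g : ℤ → X → ℝ≥0) (x : X) :
    Antitone fun k => tailGrad p a g k x := by
  intro k l hkl
  obtain ⟨m, rfl⟩ := Int.le.dest hkl
  simp only
  rw [← ENNReal.rpow_le_rpow_iff hp, tailGrad_add_rpow hp, tailGrad_rpow hp]
  exact ENNReal.tsum_comp_le_tsum_of_injective (add_left_injective m) fun n : ℕ =>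
    (ENNReal.ofReal ((2 : ℝ) ^ (-((k + n : ℤ) : ℝ) * a)) * (g (k + n) x : ℝ≥0∞)) ^ p

theorem tendsto_tailGrad {p : ℝ} (hp : 0 < p) (a : ℝ) (g : ℤ → X → ℝ≥0) (k : ℤ) (x : X)
    (hfin : tailGrad p a g k x ≠ ∞) :
    Filter.Tendsto (fun m : ℕ => tailGrad p a g (k + m) x) Filter.atTop (nhds 0) := by
  have h1 : tailGrad p a g k x ^ p ≠ ∞ := by simp [hfin, hp.le]
  rw [tailGrad_rpow hp] at h1
  have h2 := ENNReal.tendsto_sum_nat_add _ h1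
  simp_rw [← tailGrad_add_rpow hp] at h2
  have h3 := (ENNReal.continuous_rpow_const (y := 1 / p)).tendsto 0 |>.comp h2
  simp only [Function.comp_def] at h3
  rw [ENNReal.zero_rpow_of_pos (by positivity)] at h3
  simpa [← ENNReal.rpow_mul, hp.ne'] using h3

theorem aemeasurable_tailGrad [MeasurableSpace X] {ν : Measure X} (p a : ℝ) {g : ℤ → X → ℝ≥0}
    (hg : ∀ k, AEMeasurable (g k) ν) (k : ℤ) : AEMeasurable (tailGrad p a g k) ν := by
  unfold tailGrad
  refine AEMeasurable.pow_const (AEMeasurable.tsum fun n => ?_) _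
  exact (((hg (k + n)).coe_nnreal_ennreal).const_mul _).pow_const _

/-- The constant in the `L^p` bound for `tailGrad`. -/
noncomputable def tailConst (p a : ℝ) : ℝ := (2 * (1 - (2 : ℝ) ^ (-(a * p)))⁻¹) ^ (1 / p)

theorem two_rpow_neg_lt_one {c : ℝ} (hc : 0 < c) : (2 : ℝ) ^ (-c) < 1 :=
  Real.rpow_lt_one_of_one_lt_of_neg one_lt_two (by linarith)

theorem tailConst_pos {p a : ℝ} (hp : 0 < p) (ha : 0 < a) : 0 < tailConst p a := by
  have := two_rpow_neg_lt_one (mul_pos ha hp)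
  have h2 : 0 < 1 - (2 : ℝ) ^ (-(a * p)) := by linarith
  unfold tailConst
  positivity

/-- Summing over scales in `ℓ^p` lets sum and integral be exchanged for every `p > 0`. What remains
is a geometric series of ratio `2^(-(a * p))`, so a bound uniform in `k` suffices. -/
theorem lintegral_tailGrad_lt [MeasurableSpace X] {ν : Measure X} {p a M : ℝ} (hp : 0 < p)
    (ha : 0 < a) (hM : 0 < M) {g : ℤ → X → ℝ≥0} (hg : ∀ k, AEMeasurable (g k) ν)
    (hgM : ∀ k, ∫⁻ x, (g k x : ℝ≥0∞) ^ p ∂ν ≤ ENNReal.ofReal (M ^ p)) (k : ℤ) :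
    ∫⁻ x, tailGrad p a g k x ^ p ∂ν <
      ENNReal.ofReal ((tailConst p a * (2 : ℝ) ^ (-(k : ℝ) * a) * M) ^ p) := by
  have hlt := two_rpow_neg_lt_one (mul_pos ha hp)
  have h2 : 0 < 1 - (2 : ℝ) ^ (-(a * p)) := by linarith
  have hnn : (0 : ℝ) ≤ (2 : ℝ) ^ (-(a * p)) := by positivity
  simp_rw [tailGrad_rpow hp]
  rw [lintegral_tsum fun n : ℕ =>
    (((hg (k + n)).coe_nnreal_ennreal).const_mul _).pow_const _]
  calc _ ≤ ∑' n : ℕ, ENNReal.ofReal (((2 : ℝ) ^ (-(k : ℝ) * a) * M) ^ p *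
        ((2 : ℝ) ^ (-(a * p))) ^ n) := by
        refine ENNReal.tsum_le_tsum fun n => ?_
        simp_rw [ENNReal.mul_rpow_of_nonneg _ _ hp.le]
        rw [lintegral_const_mul'' _ ((hg (k + n)).coe_nnreal_ennreal.pow_const _),
          ENNReal.ofReal_rpow_of_pos (by positivity)]
        refine (mul_le_mul_right (hgM _) _).trans_eq ?_
        rw [← ENNReal.ofReal_mul (by positivity)]
        congr 1
        rw [Real.mul_rpow (by positivity) hM.le, ← Real.rpow_natCast, ← Real.rpow_mul (by norm_num),
          ← Real.rpow_mul (by norm_num), ← Real.rpow_mul (by norm_num),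
          mul_right_comm ((2 : ℝ) ^ (-(k : ℝ) * a * p)),
          ← Real.rpow_add (by norm_num)]
        congr 2
        push_cast
        ring
    _ = ENNReal.ofReal (((2 : ℝ) ^ (-(k : ℝ) * a) * M) ^ p * (1 - (2 : ℝ) ^ (-(a * p)))⁻¹) := by
        rw [← ENNReal.ofReal_tsum_of_nonneg (fun n => by positivity)
          ((summable_geometric_of_lt_one hnn hlt).mul_left _), tsum_mul_left,
          tsum_geometric_of_lt_one hnn hlt]
    -- The factor 2 in `tailConst` makes the bound strict, as the Markov argument by contradiction
    -- requires.
    _ < _ := by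
        refine (ENNReal.ofReal_lt_ofReal_iff (by have := tailConst_pos hp ha; positivity)).2 ?_
        rw [mul_assoc (tailConst p a), Real.mul_rpow (tailConst_pos hp ha).le (by positivity),
          mul_comm (tailConst p a ^ p), tailConst, ← Real.rpow_mul (by positivity),
          one_div_mul_cancel hp.ne', Real.rpow_one]
        refine mul_lt_mul_of_pos_left ?_ (by positivity)
        have : 0 < (1 - (2 : ℝ) ^ (-(a * p)))⁻¹ := by positivity
        linarith

/-- The pointwise estimate for `u` in terms of the tails of a fractional gradient. -/
theorem ofReal_abs_sub_le_tailGrad {ρ : X → X → ℝ} {A E : Set X} {s p τ : ℝ} (hp : 0 < p)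
    (hτ : τ ≤ s) {u : X → ℝ} {g : ℤ → X → ℝ≥0}
    (hg : ∀ k : ℤ, ∀ x ∈ A \ E, ∀ y ∈ A \ E,
      (2 : ℝ) ^ (-k - 1) ≤ ρ x y → ρ x y < (2 : ℝ) ^ (-k) →
        |u x - u y| ≤ ρ x y ^ s * (g k x + g k y))
    {x y : X} (hx : x ∈ A \ E) (hy : y ∈ A \ E) (hxy : 0 < ρ x y) {k : ℤ}
    (hk : ρ x y < (2 : ℝ) ^ (-k)) :
    ENNReal.ofReal |u x - u y| ≤ ENNReal.ofReal (ρ x y ^ τ) *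
      (tailGrad p (s - τ) g k x + tailGrad p (s - τ) g k y) := by
  -- Only the dyadic level `i` of `ρ x y` matters: the surplus `ρ^(s - τ) ≤ 2^(-i(s - τ))` is
  -- absorbed into the `i`-th term of the tail.
  obtain ⟨j, hj1, hj2⟩ := exists_mem_Ico_zpow (y := (2 : ℝ)) hxy one_lt_two
  obtain ⟨i, rfl⟩ : ∃ i : ℤ, j = -i - 1 := ⟨-j - 1, by ring⟩
  have hj2' : ρ x y < (2 : ℝ) ^ (-i) := by simpa using hj2
  have hki : k ≤ i := by
    have := (zpow_lt_zpow_iff_right₀ (one_lt_two (α := ℝ))).1 (hj1.trans_lt hk)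
    omega
  have h := hg i x hx y hy hj1 hj2'
  have h3 : ρ x y ^ (s - τ) ≤ (2 : ℝ) ^ (-(i : ℝ) * (s - τ)) := by
    rw [Real.rpow_mul (by norm_num)]
    refine Real.rpow_le_rpow hxy.le ?_ (by linarith)
    have : (2 : ℝ) ^ (-(i : ℝ)) = (2 : ℝ) ^ (-i) := by
      rw [← Real.rpow_intCast]; push_cast; rfl
    rw [this]
    exact hj2'.le
  have h4 : |u x - u y| ≤ ρ x y ^ τ * ((2 : ℝ) ^ (-(i : ℝ) * (s - τ)) * g i x +
      (2 : ℝ) ^ (-(i : ℝ) * (s - τ)) * g i y) := by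
    refine h.trans ?_
    have : ρ x y ^ s = ρ x y ^ τ * ρ x y ^ (s - τ) := by
      rw [← Real.rpow_add hxy]; congr 1; ring
    rw [this, mul_assoc, ← mul_add]
    gcongr
  refine (ENNReal.ofReal_le_ofReal h4).trans ?_
  rw [ENNReal.ofReal_mul (by positivity), ENNReal.ofReal_add (by positivity) (by positivity),
    ENNReal.ofReal_mul (by positivity), ENNReal.ofReal_mul (by positivity),
    ENNReal.ofReal_coe_nnreal, ENNReal.ofReal_coe_nnreal]
  gcongr
  · exact le_tailGrad hp _ g hki x
  · exact le_tailGrad hp _ g hki y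

/-! ### The sequence norm -/

theorem le_ellNorm {q : ℝ≥0∞} (hq : 0 < q) (a : ℤ → ℝ≥0∞) (k : ℤ) : a k ≤ ellNorm q a := by
  unfold ellNorm
  split_ifs with h
  · exact le_iSup a k
  · rw [one_div, ENNReal.le_rpow_inv_iff (ENNReal.toReal_pos hq.ne' h)]
    exact ENNReal.le_tsum (f := fun k => a k ^ q.toReal) k

theorem exists_fracGradient_of_besovSeminorm_lt [MeasurableSpace X] {ρ : X → X → ℝ}
    {μ : Measure X} {A : Set X} {s p : ℝ} {q : ℝ≥0∞} (hp : 0 < p) (hq : 0 < q) {u : X → ℝ} {M : ℝ}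
    (hM : besovSeminorm ρ μ A s p q u < ENNReal.ofReal M) :
    ∃ g, IsFracGradient ρ μ A s u g ∧
      ∀ k, ∫⁻ x in A, (g k x : ℝ≥0∞) ^ p ∂μ ≤ ENNReal.ofReal (M ^ p) := by
  have hM0 : 0 < M := ENNReal.ofReal_pos.1 (bot_le.trans_lt hM)
  obtain ⟨g, hg⟩ := iInf_lt_iff.1 hM
  obtain ⟨hg, hlt⟩ := iInf_lt_iff.1 hg
  refine ⟨g, hg, fun k => ?_⟩
  have h := (le_ellNorm hq _ k).trans hlt.le
  rw [eLpNorm_eq_lintegral_rpow_enorm_toReal (by simpa using hp) ENNReal.ofReal_ne_top,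
    ENNReal.toReal_ofReal hp.le, one_div, ENNReal.rpow_inv_le_iff hp,
    ENNReal.ofReal_rpow_of_pos hM0] at h
  simpa using h

/-! ### Good points in balls -/

/-- A Markov-type inequality: a set of measure at least `v` contains, off any null set, a point at
which a given function is controlled by its `L^p` norm. -/
theorem exists_le_of_lintegral_lt [MeasurableSpace X] {μ : Measure X} {A B E : Set X}
    (hB : NullMeasurableSet B μ) (hBA : B ⊆ A) (hE : μ E = 0) {p K v : ℝ} (hp : 0 < p) (hK : 0 < K)
    (hv : 0 < v) (hvB : ENNReal.ofReal v ≤ μ B) {F : X → ℝ≥0∞}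
    (hF : ∫⁻ x in A, F x ^ p ∂μ < ENNReal.ofReal (K ^ p)) :
    ∃ y ∈ B, y ∉ E ∧ F y ≤ ENNReal.ofReal (K * v ^ (-1 / p)) := by
  by_contra! hcon
  have h1 : ∫⁻ _ in B, ENNReal.ofReal (K * v ^ (-1 / p)) ^ p ∂μ ≤ ∫⁻ x in B, F x ^ p ∂μ := by
    refine lintegral_mono_ae ((ae_restrict_iff'₀ hB).2 ?_)
    have : ∀ᵐ x ∂μ, x ∉ E := measure_eq_zero_iff_ae_notMem.1 hE
    filter_upwards [this] with x hx hxB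
    exact ENNReal.rpow_le_rpow (hcon x hxB hx).le hp.le
  rw [setLIntegral_const, ENNReal.ofReal_rpow_of_pos (by positivity)] at h1
  have h2 : ENNReal.ofReal (K ^ p) ≤ ENNReal.ofReal ((K * v ^ (-1 / p)) ^ p) * μ B := by
    refine le_trans (le_of_eq ?_) (mul_le_mul_right hvB _)
    rw [← ENNReal.ofReal_mul (by positivity), Real.mul_rpow hK.le (by positivity),
      ← Real.rpow_mul hv.le, div_mul_cancel₀ _ hp.ne', Real.rpow_neg_one, mul_assoc,
      inv_mul_cancel₀ hv.ne', mul_one]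
  exact absurd (h2.trans (h1.trans (lintegral_mono_set hBA))) (not_le.2 hF)

/-- A fractional gradient `g` of `u` on `σB₀` off a null set `E`, with `L^p` norms bounded by `M`,
together with the standing assumptions on the space and on the ball `B₀ = B_ρ(x₀, R₀)`. -/
structure HasBoundedGradient [MeasurableSpace X] (ρ : X → X → ℝ) (μ : Measure X) (κ : ℝ) (x₀ : X)
    (R₀ σ s p Q b M : ℝ) (u : X → ℝ) (g : ℤ → X → ℝ≥0) (E : Set X) : Prop where
  isQuasiMetric : IsQuasiMetric ρ
  isQuasiBound : IsQuasiBound ρ κ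
  isBallMeasure : IsBallMeasure ρ μ
  quasiConst_le : quasiConst ρ ≤ σ
  one_le_quasiConst : 1 ≤ quasiConst ρ
  radius_pos : 0 < R₀
  s_pos : 0 < s
  p_pos : 0 < p
  Q_pos : 0 < Q
  b_pos : 0 < b
  M_pos : 0 < M
  vCondition : VCondition ρ μ x₀ R₀ σ Q b
  aemeasurable : ∀ k, AEMeasurable (g k) (μ.restrict (qball ρ x₀ (σ * R₀)))
  lintegral_le : ∀ k,
    ∫⁻ x in qball ρ x₀ (σ * R₀), (g k x : ℝ≥0∞) ^ p ∂μ ≤ ENNReal.ofReal (M ^ p)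
  null : μ E = 0
  abs_sub_le_gradient : ∀ k : ℤ, ∀ x ∈ qball ρ x₀ (σ * R₀) \ E, ∀ y ∈ qball ρ x₀ (σ * R₀) \ E,
    (2 : ℝ) ^ (-k - 1) ≤ ρ x y → ρ x y < (2 : ℝ) ^ (-k) →
      |u x - u y| ≤ ρ x y ^ s * (g k x + g k y)

namespace HasBoundedGradient

variable [MeasurableSpace X] {ρ : X → X → ℝ} {μ : Measure X} {κ : ℝ} {x₀ : X}
  {R₀ σ s p Q b M : ℝ} {u : X → ℝ} {g : ℤ → X → ℝ≥0} {E : Set X}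

theorem kappa_pos (h : HasBoundedGradient ρ μ κ x₀ R₀ σ s p Q b M u g E) : 0 < κ :=
  one_pos.trans_le h.isQuasiBound.one_le

theorem qball_subset (h : HasBoundedGradient ρ μ κ x₀ R₀ σ s p Q b M u g E) {x : X}
    (hx : x ∈ qball ρ x₀ R₀) {r : ℝ} (hr : r ≤ R₀) : qball ρ x r ⊆ qball ρ x₀ (σ * R₀) :=
  qball_subset_qball_of_mem h.isQuasiMetric h.one_le_quasiConst h.quasiConst_le hx hr

theorem center_mem (h : HasBoundedGradient ρ μ κ x₀ R₀ σ s p Q b M u g E) :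
    x₀ ∈ qball ρ x₀ R₀ := by
  show ρ x₀ x₀ < R₀
  rw [h.isQuasiMetric.self_eq_zero]
  exact h.radius_pos

theorem subset_dilate (h : HasBoundedGradient ρ μ κ x₀ R₀ σ s p Q b M u g E) :
    qball ρ x₀ R₀ ⊆ qball ρ x₀ (σ * R₀) :=
  h.qball_subset h.center_mem le_rfl

theorem one_le_sigma (h : HasBoundedGradient ρ μ κ x₀ R₀ σ s p Q b M u g E) : 1 ≤ σ :=
  h.one_le_quasiConst.trans h.quasiConst_le

theorem ofReal_le_measure (h : HasBoundedGradient ρ μ κ x₀ R₀ σ s p Q b M u g E) {x : X}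
    (hx : x ∈ qball ρ x₀ R₀) {r : ℝ} (hr : 0 < r) (hrR : r ≤ R₀) :
    ENNReal.ofReal (b * r ^ Q) ≤ μ (qball ρ x r) :=
  h.vCondition x r hr (hrR.trans (le_mul_of_one_le_left h.radius_pos.le h.one_le_sigma))
    (h.qball_subset hx hrR)

theorem lintegral_tailGrad_lt (h : HasBoundedGradient ρ μ κ x₀ R₀ σ s p Q b M u g E) {a : ℝ}
    (ha : 0 < a) (k : ℤ) :
    ∫⁻ x in qball ρ x₀ (σ * R₀), tailGrad p a g k x ^ p ∂μ <
      ENNReal.ofReal ((tailConst p a * (2 : ℝ) ^ (-(k : ℝ) * a) * M) ^ p) :=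
  HajlaszBesov.lintegral_tailGrad_lt h.p_pos ha h.M_pos h.aemeasurable h.lintegral_le k

theorem ae_tailGrad_ne_top (h : HasBoundedGradient ρ μ κ x₀ R₀ σ s p Q b M u g E) {a : ℝ}
    (ha : 0 < a) (k : ℤ) :
    ∀ᵐ x ∂μ.restrict (qball ρ x₀ R₀), x ∈ qball ρ x₀ R₀ ∧ x ∉ E ∧ tailGrad p a g k x ≠ ∞ := by
  have h1 : ∀ᵐ x ∂μ.restrict (qball ρ x₀ (σ * R₀)), tailGrad p a g k x ^ p < ∞ :=
    ae_lt_top' ((aemeasurable_tailGrad p a h.aemeasurable k).pow_const p)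
      ((h.lintegral_tailGrad_lt ha k).trans ENNReal.ofReal_lt_top).ne
  have h2 : ∀ᵐ x ∂μ.restrict (qball ρ x₀ R₀), x ∈ qball ρ x₀ R₀ :=
    ae_restrict_mem₀ (h.isBallMeasure.nullMeasurable_ball _ _ h.radius_pos)
  have h3 : ∀ᵐ x ∂μ.restrict (qball ρ x₀ R₀), x ∉ E :=
    ae_restrict_of_ae (measure_eq_zero_iff_ae_notMem.1 h.null)
  filter_upwards [ae_restrict_of_ae_restrict_of_subset h.subset_dilate h1, h2, h3] with x hx hx2 hx3
  refine ⟨hx2, hx3, fun htop => ?_⟩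
  rw [htop, ENNReal.top_rpow_of_pos h.p_pos] at hx
  exact lt_irrefl _ hx

/-- Every ball with center in `B₀` and radius at most `R₀` contains a point at which the tail of
the gradient is controlled. -/
theorem exists_tailGrad_le (h : HasBoundedGradient ρ μ κ x₀ R₀ σ s p Q b M u g E) {a : ℝ}
    (ha : 0 < a) {x : X} (hx : x ∈ qball ρ x₀ R₀) {r : ℝ} (hr : 0 < r) (hrR : r ≤ R₀) {k : ℤ}
    {D : ℝ} (hD : (2 : ℝ) ^ (-k) ≤ D) :
    ∃ y ∈ qball ρ x r, y ∈ qball ρ x₀ (σ * R₀) \ E ∧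
      tailGrad p a g k y ≤
        ENNReal.ofReal (tailConst p a * D ^ a * M * b ^ (-1 / p) * r ^ (-(Q / p))) := by
  have hb := h.b_pos
  have hM := h.M_pos
  have hT := tailConst_pos h.p_pos ha
  obtain ⟨y, hy, hyE, hle⟩ := exists_le_of_lintegral_lt
    (h.isBallMeasure.nullMeasurable_ball x r hr) (h.qball_subset hx hrR) h.null h.p_pos
    (by positivity) (by positivity) (h.ofReal_le_measure hx hr hrR) (h.lintegral_tailGrad_lt ha k)
  refine ⟨y, hy, ⟨h.qball_subset hx hrR hy, hyE⟩, hle.trans (ENNReal.ofReal_le_ofReal ?_)⟩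
  have e1 : (b * r ^ Q) ^ (-1 / p) = b ^ (-1 / p) * r ^ (-(Q / p)) := by
    rw [Real.mul_rpow hb.le (by positivity), ← Real.rpow_mul hr.le]
    congr 2
    ring
  have e2 : (2 : ℝ) ^ (-(k : ℝ) * a) ≤ D ^ a := by
    rw [Real.rpow_mul (by norm_num)]
    refine Real.rpow_le_rpow (by positivity) ?_ ha.le
    have : (2 : ℝ) ^ (-(k : ℝ)) = (2 : ℝ) ^ (-k) := by
      rw [← Real.rpow_intCast]; push_cast; rfl
    rwa [this]
  rw [e1, ← mul_assoc]
  gcongr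

theorem abs_sub_le_of_tailGrad_le (h : HasBoundedGradient ρ μ κ x₀ R₀ σ s p Q b M u g E) {τ : ℝ}
    (hτ0 : 0 ≤ τ) (hτ : τ ≤ s) {x y : X} (hx : x ∈ qball ρ x₀ (σ * R₀) \ E)
    (hy : y ∈ qball ρ x₀ (σ * R₀) \ E) {k : ℤ} (hk : ρ x y < (2 : ℝ) ^ (-k)) {α β d : ℝ}
    (hα : 0 ≤ α) (hβ : 0 ≤ β) (hxα : tailGrad p (s - τ) g k x ≤ ENNReal.ofReal α)
    (hyβ : tailGrad p (s - τ) g k y ≤ ENNReal.ofReal β) (hd : ρ x y ≤ d) :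
    |u x - u y| ≤ d ^ τ * (α + β) := by
  have hd0 : 0 ≤ d := (h.isQuasiMetric.nonneg x y).trans hd
  rcases eq_or_ne x y with rfl | hxy
  · simp only [sub_self, abs_zero]
    positivity
  · have hpos := h.isQuasiMetric.pos hxy
    have h1 := ofReal_abs_sub_le_tailGrad h.p_pos hτ h.abs_sub_le_gradient hx hy hpos hk
    rw [← ENNReal.ofReal_le_ofReal_iff (by positivity)]
    refine h1.trans ?_
    rw [ENNReal.ofReal_mul (by positivity), ENNReal.ofReal_add hα hβ]
    gcongr

end HasBoundedGradient

/-! ### Hölder representative for `Q/p < s` -/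

/-- The constant in the Hölder estimate. -/
noncomputable def holderConst (κ s p η : ℝ) : ℝ :=
  tailConst p s * (8 * κ ^ 4) ^ s * (2 + 4 / (1 - (2 : ℝ) ^ (-(s - η))))

theorem holderConst_pos {κ s p η : ℝ} (hκ : 0 < κ) (hs : 0 < s) (hp : 0 < p) (hη : η < s) :
    0 < holderConst κ s p η := by
  have := tailConst_pos hp hs
  have h2 : 0 < 1 - (2 : ℝ) ^ (-(s - η)) := by linarith [two_rpow_neg_lt_one (sub_pos.2 hη)]
  unfold holderConst
  positivity

theorem exists_int_two_zpow_neg {x : ℝ} (hx : 0 < x) :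
    ∃ k : ℤ, x < (2 : ℝ) ^ (-k) ∧ (2 : ℝ) ^ (-k) ≤ 2 * x := by
  obtain ⟨j, hj1, hj2⟩ := exists_mem_Ico_zpow (y := (2 : ℝ)) hx one_lt_two
  refine ⟨-(j + 1), by simpa using hj2, ?_⟩
  rw [neg_neg, zpow_add_one₀ two_ne_zero, mul_comm]
  gcongr

/-- The parameter `η` keeps `Q/p` away from `s`, so that the constant does not involve `Q`. -/
theorem HasBoundedGradient.exists_holder [MeasurableSpace X] {ρ : X → X → ℝ} {μ : Measure X}
    {κ : ℝ} {x₀ : X} {R₀ σ s p Q b M : ℝ} {u : X → ℝ} {g : ℤ → X → ℝ≥0} {E : Set X}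
    (h : HasBoundedGradient ρ μ κ x₀ R₀ σ s p Q b M u g E) {η : ℝ} (hη : η < s)
    (hQ : Q / p ≤ η) :
    ∃ v : X → ℝ, v =ᵐ[μ.restrict (qball ρ x₀ R₀)] u ∧
      ∀ x ∈ qball ρ x₀ R₀, ∀ y ∈ qball ρ x₀ R₀,
        |v x - v y| ≤ holderConst κ s p η * b ^ (-1 / p) * ρ x y ^ (s - Q / p) * M := by
  have hκ := h.isQuasiBound.one_le
  have hκ0 := h.kappa_pos
  have hR := h.radius_pos
  have hs := h.s_pos
  have hp := h.p_pos
  have hb := h.b_pos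
  have hM := h.M_pos
  have hT := tailConst_pos hp hs
  set θ := s - Q / p with hθ_def
  have hδ : 0 < s - η := sub_pos.2 hη
  have hθ : s - η ≤ θ := by linarith
  have hθ0 : 0 < θ := hδ.trans_le hθ
  set ω : ℝ := (2 : ℝ) ^ (-(s - η)) with hω_def
  have hω0 : 0 < ω := by positivity
  have hω1 : ω < 1 := two_rpow_neg_lt_one hδ
  set W : ℝ := tailConst p s * (8 * κ ^ 4) ^ s * M * b ^ (-1 / p) with hW_def
  have hW : 0 < W := by positivity
  -- The margin `4 * κ ^ 4` ensures that all pairs compared below at scale `r n` are closer than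
  -- `2^(-(k₀ + n))`.
  obtain ⟨k₀, hk₀, hk₀'⟩ := exists_int_two_zpow_neg (x := 4 * κ ^ 4 * R₀) (by positivity)
  set r : ℕ → ℝ := fun n => R₀ * (1 / 2) ^ n with hr_def
  have hr0 : ∀ n, 0 < r n := fun n => by positivity
  have hrR : ∀ n, r n ≤ R₀ := fun n =>
    mul_le_of_le_one_right hR.le (pow_le_one₀ (by norm_num) (by norm_num))
  have hrs : ∀ n, r n = 2 * r (n + 1) := fun n => by simp only [hr_def, pow_succ]; ring
  have hzp : ∀ n : ℕ, (2 : ℝ) ^ (-(k₀ + n : ℤ)) = (2 : ℝ) ^ (-k₀) * (1 / 2) ^ n := fun n => by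
    rw [neg_add, zpow_add₀ two_ne_zero, zpow_neg _ (n : ℤ), zpow_natCast, one_div, inv_pow]
  have hk1 : ∀ n : ℕ, 4 * κ ^ 4 * r n < (2 : ℝ) ^ (-(k₀ + n : ℤ)) := fun n => by
    rw [hzp, hr_def]
    calc 4 * κ ^ 4 * (R₀ * (1 / 2) ^ n) = 4 * κ ^ 4 * R₀ * (1 / 2) ^ n := by ring
      _ < _ := by gcongr
  have hk2 : ∀ n : ℕ, (2 : ℝ) ^ (-(k₀ + n : ℤ)) ≤ 8 * κ ^ 4 * r n := fun n => by
    rw [hzp, hr_def]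
    calc (2 : ℝ) ^ (-k₀) * (1 / 2) ^ n ≤ 2 * (4 * κ ^ 4 * R₀) * (1 / 2) ^ n := by gcongr
      _ = _ := by ring
  have hgood : ∀ x : X, ∀ n : ℕ, ∃ y : X, x ∈ qball ρ x₀ R₀ → y ∈ qball ρ x (r n) ∧
      y ∈ qball ρ x₀ (σ * R₀) \ E ∧ tailGrad p s g (k₀ + n) y ≤ ENNReal.ofReal (W * r n ^ θ) := by
    intro x n
    by_cases hx : x ∈ qball ρ x₀ R₀
    · obtain ⟨y, hy, hyA, hyT⟩ := h.exists_tailGrad_le hs hx (hr0 n) (hrR n) (hk2 n)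
      refine ⟨y, fun _ => ⟨hy, hyA, hyT.trans_eq ?_⟩⟩
      congr 1
      rw [Real.mul_rpow (by positivity) (hr0 n).le, hθ_def, sub_eq_add_neg, Real.rpow_add (hr0 n),
        hW_def]
      ring
    · exact ⟨x, fun hx' => absurd hx' hx⟩
  choose y hy using hgood
  have hdiff : ∀ z w : X, z ∈ qball ρ x₀ (σ * R₀) \ E → w ∈ qball ρ x₀ (σ * R₀) \ E → ∀ n : ℕ,
      ∀ α β : ℝ, 0 ≤ α → 0 ≤ β → ρ z w < (2 : ℝ) ^ (-(k₀ + n : ℤ)) →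
      tailGrad p s g (k₀ + n) z ≤ ENNReal.ofReal α →
      tailGrad p s g (k₀ + n) w ≤ ENNReal.ofReal β → |u z - u w| ≤ α + β := by
    intro z w hz hw n α β hα hβ hzw h1 h2
    simpa using h.abs_sub_le_of_tailGrad_le (τ := 0) le_rfl hs.le hz hw hzw hα hβ
      (by simpa using h1) (by simpa using h2) le_rfl
  have ht0 : ∀ n, 0 ≤ W * r n ^ θ := fun n => by have := hr0 n; positivity
  -- The ratio `ω` is built from `s - η ≤ θ` rather than from `θ`, which depends on `Q`.
  have hts : ∀ n, W * r (n + 1) ^ θ ≤ W * r n ^ θ * ω := fun n => by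
    rw [hrs n, Real.mul_rpow zero_le_two (hr0 _).le]
    have : 1 ≤ (2 : ℝ) ^ θ * ω := by
      rw [hω_def, ← Real.rpow_add two_pos]
      exact Real.one_le_rpow one_le_two (by linarith)
    have h2 := ht0 (n + 1)
    nlinarith
  have htn : ∀ n m, W * r (n + m) ^ θ ≤ W * r n ^ θ * ω ^ m := fun n m => by
    induction m with
    | zero => simp
    | succ m ih =>
      rw [pow_succ, ← mul_assoc, ← add_assoc]
      exact (hts _).trans (mul_le_mul_of_nonneg_right ih hω0.le)
  have hstep : ∀ x ∈ qball ρ x₀ R₀, ∀ n : ℕ, |u (y x n) - u (y x (n + 1))| ≤ 2 * (W * r n ^ θ) := by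
    intro x hx n
    obtain ⟨h1, h2, h3⟩ := hy x n hx
    obtain ⟨h1', h2', h3'⟩ := hy x (n + 1) hx
    have hlt : ρ (y x n) (y x (n + 1)) < (2 : ℝ) ^ (-(k₀ + (n + 1 : ℕ) : ℤ)) := by
      refine (h.isQuasiBound.lt_of_mem_qball h1 ?_).trans (lt_of_le_of_lt ?_ (hk1 _))
      · exact lt_of_lt_of_le (show ρ x (y x (n + 1)) < r (n + 1) from h1')
          (by rw [hrs n]; linarith [hr0 (n + 1)])
      · rw [hrs n]
        have : κ ^ 2 ≤ κ ^ 4 := pow_le_pow_right₀ hκ (by norm_num)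
        nlinarith [hr0 (n + 1), mul_le_mul_of_nonneg_right this (hr0 (n + 1)).le]
    -- Both points are compared at the finer level `n + 1`; the coarser control of `y x n` passes
    -- there by monotonicity of the tails.
    have hmono := tailGrad_antitone hp s g (y x n)
      (show k₀ + (n : ℤ) ≤ k₀ + (n + 1 : ℕ) by push_cast; linarith)
    have := hdiff _ _ h2 h2' (n + 1) _ _ (ht0 n) (ht0 (n + 1)) hlt (hmono.trans h3) h3'
    have h4 := hts n
    have h5 := ht0 n
    nlinarith
  have hgeo : ∀ x ∈ qball ρ x₀ R₀, ∀ n m : ℕ,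
      dist (u (y x (n + m))) (u (y x (n + (m + 1)))) ≤ 2 * (W * r n ^ θ) * ω ^ m := by
    intro x hx n m
    rw [Real.dist_eq, ← add_assoc]
    have := hstep x hx (n + m)
    have := htn n m
    linarith
  have hlim : ∀ x : X, ∃ l : ℝ, x ∈ qball ρ x₀ R₀ →
      Filter.Tendsto (fun n => u (y x n)) Filter.atTop (nhds l) := by
    intro x
    by_cases hx : x ∈ qball ρ x₀ R₀
    · have := cauchySeq_of_le_geometric ω _ hω1 (f := fun n => u (y x n)) fun m => by
        simpa using hgeo x hx 0 m
      obtain ⟨l, hl⟩ := cauchySeq_tendsto_of_complete this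
      exact ⟨l, fun _ => hl⟩
    · exact ⟨0, fun hx' => absurd hx' hx⟩
  choose v hv using hlim
  have hvy : ∀ x ∈ qball ρ x₀ R₀, ∀ n : ℕ,
      |u (y x n) - v x| ≤ 2 * (W * r n ^ θ) / (1 - ω) := by
    intro x hx n
    have ht : Filter.Tendsto (fun m => u (y x (n + m))) Filter.atTop (nhds (v x)) := by
      have := (Filter.tendsto_add_atTop_iff_nat n).2 (hv x hx)
      simpa [add_comm] using this
    simpa [Real.dist_eq] using dist_le_of_le_geometric_of_tendsto₀ ω _ hω1 (hgeo x hx n) ht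
  refine ⟨v, ?_, fun x hx z hz => ?_⟩
  -- Where the tail is finite, it tends to zero as the level grows, so `u (y x n)` also converges to
  -- `u x`.
  · filter_upwards [h.ae_tailGrad_ne_top hs k₀] with x ⟨hx, hxE, hxT⟩
    have hlt : ∀ n, |u x - u (y x n)| ≤ (tailGrad p s g (k₀ + n) x).toReal + W * r n ^ θ := by
      intro n
      obtain ⟨h1, h2, h3⟩ := hy x n hx
      refine hdiff _ _ ⟨h.subset_dilate hx, hxE⟩ h2 n _ _ ENNReal.toReal_nonneg (ht0 n) ?_ ?_ h3
      · refine lt_trans (show ρ x (y x n) < r n from h1) (lt_of_le_of_lt ?_ (hk1 n))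
        have : 1 ≤ κ ^ 4 := one_le_pow₀ hκ
        nlinarith [hr0 n, mul_le_mul_of_nonneg_right this (hr0 n).le]
      · rw [ENNReal.ofReal_toReal]
        exact ne_top_of_le_ne_top hxT
          (tailGrad_antitone hp s g x (show k₀ ≤ k₀ + (n : ℤ) by linarith))
    have hto1 : Filter.Tendsto (fun n : ℕ => (tailGrad p s g (k₀ + n) x).toReal) Filter.atTop
        (nhds 0) := by
      simpa [Function.comp_def] using (ENNReal.tendsto_toReal ENNReal.zero_ne_top).comp
        (tendsto_tailGrad hp s g k₀ x hxT)
    have hto2 : Filter.Tendsto (fun n : ℕ => W * r n ^ θ) Filter.atTop (nhds 0) := by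
      refine squeeze_zero ht0 (fun n => by simpa using htn 0 n) ?_
      simpa using (tendsto_pow_atTop_nhds_zero_of_lt_one hω0.le hω1).const_mul (W * r 0 ^ θ)
    have hto3 : Filter.Tendsto (fun n => |u x - u (y x n)|) Filter.atTop (nhds 0) :=
      squeeze_zero (fun _ => abs_nonneg _) hlt (by simpa using hto1.add hto2)
    have hto4 : Filter.Tendsto (fun n => |u x - u (y x n)|) Filter.atTop (nhds |u x - v x|) :=
      ((hv x hx).const_sub (u x)).abs
    have := tendsto_nhds_unique hto4 hto3
    linarith [abs_eq_zero.1 this]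
  · rcases eq_or_ne x z with rfl | hxz
    · have := holderConst_pos hκ0 hs hp hη
      have := h.isQuasiMetric.nonneg x x
      simp only [sub_self, abs_zero]
      positivity
    have hd := h.isQuasiMetric.pos hxz
    have hd' : ρ x z < κ ^ 2 * R₀ := h.isQuasiBound.lt_of_mem_qball hx hz
    set d := ρ x z with hd_def
    -- The distance `d` may exceed `R₀`, up to the factor `κ ^ 2`, while good points exist only at
    -- scales at most `R₀`; hence the minimum.
    have hdm : 0 < min d R₀ / R₀ := div_pos (lt_min hd hR) hR
    obtain ⟨n, hn1, hn2⟩ := exists_nat_pow_near_of_lt_one hdm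
      ((div_le_one hR).2 (min_le_right d R₀)) (show (0 : ℝ) < 1 / 2 by norm_num) (by norm_num)
    have hn1 : r (n + 1) < min d R₀ := by
      rw [lt_div_iff₀ hR] at hn1
      simpa only [hr_def, mul_comm] using hn1
    have hn2 : min d R₀ ≤ 2 * r (n + 1) := by
      rw [← hrs, hr_def]
      rw [div_le_iff₀ hR] at hn2
      simpa only [mul_comm] using hn2
    have hdm2 : d ≤ κ ^ 2 * min d R₀ := by
      rcases le_total d R₀ with hle | hle
      · rw [min_eq_left hle]
        exact le_mul_of_one_le_left hd.le (one_le_pow₀ hκ)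
      · rw [min_eq_right hle]
        exact hd'.le
    obtain ⟨h1, h2, h3⟩ := hy x (n + 1) hx
    obtain ⟨h1', h2', h3'⟩ := hy z (n + 1) hz
    set ϱ := r (n + 1) with hϱ_def
    have hϱ : 0 < ϱ := hr0 _
    have hlt : ρ (y x (n + 1)) (y z (n + 1)) < (2 : ℝ) ^ (-(k₀ + (n + 1 : ℕ) : ℤ)) := by
      refine lt_of_lt_of_le ?_ (hk1 (n + 1)).le
      have hκ2 : 1 ≤ κ ^ 2 := one_le_pow₀ hκ
      have hdϱ : d < 3 * κ ^ 2 * ϱ := by nlinarith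
      have hz' : ρ x (y z (n + 1)) < κ * (3 * κ ^ 2 * ϱ) :=
        h.isQuasiBound.lt_of_lt hdϱ (lt_of_lt_of_le h1' (by nlinarith))
      have hx' : ρ (y x (n + 1)) x < κ * (3 * κ ^ 2 * ϱ) :=
        h.isQuasiBound.symm_lt (lt_of_lt_of_le h1 (by nlinarith))
      have := h.isQuasiBound.lt_of_lt hx' hz'
      have h4 : 0 < κ ^ 4 * ϱ := by positivity
      calc _ < κ * (κ * (3 * κ ^ 2 * ϱ)) := this
        _ = 3 * (κ ^ 4 * ϱ) := by ring
        _ ≤ 4 * (κ ^ 4 * ϱ) := by linarith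
        _ = _ := by rw [hϱ_def]; ring
    have hA := hdiff _ _ h2 h2' (n + 1) _ _ (ht0 _) (ht0 _) hlt h3 h3'
    have hB := hvy x hx (n + 1)
    have hC := hvy z hz (n + 1)
    have hω' : 0 < 1 - ω := by linarith
    have hϱd : ϱ ^ θ ≤ d ^ θ := Real.rpow_le_rpow hϱ.le (hn1.le.trans (min_le_left _ _)) hθ0.le
    calc |v x - v z| = |-(u (y x (n + 1)) - v x) + (u (y x (n + 1)) - u (y z (n + 1)))
          + (u (y z (n + 1)) - v z)| := by congr 1; ring
      _ ≤ |u (y x (n + 1)) - v x| + |u (y x (n + 1)) - u (y z (n + 1))|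
          + |u (y z (n + 1)) - v z| := by
          refine (abs_add_le _ _).trans (add_le_add_left ((abs_add_le _ _).trans ?_) _)
          rw [abs_neg]
      -- Two geometric tails towards `v x` and `v z`, plus one comparison of the good points near
      -- `x` and `z`.
      _ ≤ 2 * (W * ϱ ^ θ) / (1 - ω) + (W * ϱ ^ θ + W * ϱ ^ θ) + 2 * (W * ϱ ^ θ) / (1 - ω) := by
          gcongr
      _ = W * (2 + 4 / (1 - ω)) * ϱ ^ θ := by ring
      _ ≤ W * (2 + 4 / (1 - ω)) * d ^ θ := by gcongr
      _ = _ := by rw [hW_def, holderConst]; ring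

/-! ### Sobolev–Poincaré estimate for `Q/p > ε` -/

/-- The constant in the Sobolev–Poincaré estimate. -/
noncomputable def sobolevConst (κ s p ε δ : ℝ) : ℝ :=
  (2 + 2 * (2 * κ ^ 3) ^ ε / (1 - (2 : ℝ) ^ (-δ))) *
    (tailConst p (s - ε) * (8 * κ ^ 4) ^ (s - ε))

theorem sobolevConst_pos {κ s p ε δ : ℝ} (hκ : 0 < κ) (hp : 0 < p) (hε : ε < s) (hδ : 0 < δ) :
    0 < sobolevConst κ s p ε δ := by
  have := tailConst_pos hp (sub_pos.2 hε)
  have h2 : 0 < 1 - (2 : ℝ) ^ (-δ) := by linarith [two_rpow_neg_lt_one hδ]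
  unfold sobolevConst
  positivity

section

variable [MeasurableSpace X] {ρ : X → X → ℝ} {μ : Measure X} {κ : ℝ} {x₀ : X}
  {R₀ σ s p Q b M : ℝ} {u : X → ℝ} {g : ℤ → X → ℝ≥0} {E : Set X}

/-- The chaining argument: a point `y` of `B_ρ(x, r)` with controlled gradient is compared with the
reference point `z` through points in the balls `B_ρ(x, 2 ^ j * r)`. -/
theorem HasBoundedGradient.abs_sub_le_of_chain
    (h : HasBoundedGradient ρ μ κ x₀ R₀ σ s p Q b M u g E) {ε δ : ℝ} (hε : 0 < ε) (hεs : ε < s)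
    (hδ : 0 < δ) (hQ : ε + δ ≤ Q / p) {k : ℤ} (hk : 4 * κ ^ 4 * R₀ < (2 : ℝ) ^ (-k)) {W : ℝ}
    (hW : 0 < W)
    (hgood : ∀ x ∈ qball ρ x₀ R₀, ∀ r, 0 < r → r ≤ R₀ → ∃ y ∈ qball ρ x r,
      y ∈ qball ρ x₀ (σ * R₀) \ E ∧ tailGrad p (s - ε) g k y ≤ ENNReal.ofReal (W * r ^ (-(Q / p))))
    {z : X} (hz : z ∈ qball ρ x₀ R₀) (hzA : z ∈ qball ρ x₀ (σ * R₀) \ E)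
    (hzT : tailGrad p (s - ε) g k z ≤ ENNReal.ofReal (W * R₀ ^ (-(Q / p))))
    {x : X} (hx : x ∈ qball ρ x₀ R₀) (n : ℕ) :
    ∀ r, 0 < r → r ≤ R₀ → R₀ < 2 ^ (n + 1) * r → ∀ y ∈ qball ρ x r,
      y ∈ qball ρ x₀ (σ * R₀) \ E →
      tailGrad p (s - ε) g k y ≤ ENNReal.ofReal (W * r ^ (-(Q / p))) →
      |u y - u z| ≤ 2 * (2 * κ ^ 3) ^ ε / (1 - (2 : ℝ) ^ (-δ)) * (W * r ^ (ε - Q / p)) := by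
  have hκ := h.isQuasiBound.one_le
  have hκ0 := h.kappa_pos
  have hR := h.radius_pos
  have hω1 := two_rpow_neg_lt_one hδ
  set ω : ℝ := (2 : ℝ) ^ (-δ) with hω_def
  have hω0 : 0 < ω := by positivity
  have hω' : 0 < 1 - ω := by linarith
  set c : ℝ := 2 * (2 * κ ^ 3) ^ ε with hc_def
  have hc : 0 < c := by positivity
  have hκ12 : κ ≤ κ ^ 2 := by nlinarith
  have hκ23 : κ ^ 2 ≤ κ ^ 3 := pow_le_pow_right₀ hκ (by norm_num)
  have hκ34 : κ ^ 3 ≤ κ ^ 4 := pow_le_pow_right₀ hκ (by norm_num)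
  have hQ0 : 0 ≤ Q / p := by linarith
  have hnear : ∀ r, 0 < r → ∀ y w : X, y ∈ qball ρ x₀ (σ * R₀) \ E →
      w ∈ qball ρ x₀ (σ * R₀) \ E → ∀ t, r ≤ t → ρ y w < (2 : ℝ) ^ (-k) →
      ρ y w ≤ 2 * κ ^ 3 * r →
      tailGrad p (s - ε) g k y ≤ ENNReal.ofReal (W * r ^ (-(Q / p))) →
      tailGrad p (s - ε) g k w ≤ ENNReal.ofReal (W * t ^ (-(Q / p))) →
      |u y - u w| ≤ c * (W * r ^ (ε - Q / p)) := by
    intro r hr y w hy hw t hrt h1 h2 hyT hwT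
    have hT : W * t ^ (-(Q / p)) ≤ W * r ^ (-(Q / p)) :=
      mul_le_mul_of_nonneg_left (Real.rpow_le_rpow_of_nonpos hr hrt (by linarith)) hW.le
    refine (h.abs_sub_le_of_tailGrad_le hε.le hεs.le hy hw h1 (by positivity) (by positivity) hyT
      (hwT.trans (ENNReal.ofReal_le_ofReal hT)) h2).trans_eq ?_
    rw [Real.mul_rpow (by positivity) hr.le, sub_eq_add_neg, Real.rpow_add hr, hc_def]
    ring
  -- End of the chain: `r` is comparable to `R₀`, so `y` is compared with `z` directly.
  have hlast : ∀ r, 0 < r → r ≤ R₀ → R₀ < 2 * r → ∀ y ∈ qball ρ x r,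
      y ∈ qball ρ x₀ (σ * R₀) \ E →
      tailGrad p (s - ε) g k y ≤ ENNReal.ofReal (W * r ^ (-(Q / p))) →
      |u y - u z| ≤ c / (1 - ω) * (W * r ^ (ε - Q / p)) := by
    intro r hr hrR hRr y hy hyA hyT
    have hxz := h.isQuasiBound.lt_of_mem_qball hx hz
    have hyx : ρ y x < κ ^ 2 * R₀ :=
      (h.isQuasiBound.symm_lt (show ρ x y < r from hy)).trans_le (by gcongr)
    have hyz : ρ y z < κ ^ 3 * R₀ := by
      have := h.isQuasiBound.lt_of_lt hyx hxz
      calc _ < _ := this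
        _ = _ := by ring
    refine (hnear r hr y z hyA hzA R₀ hrR (hyz.trans_le (le_trans ?_ hk.le)) (hyz.le.trans ?_)
      hyT hzT).trans ?_
    · nlinarith [mul_le_mul_of_nonneg_right hκ34 hR.le, pow_pos hκ0 4]
    · nlinarith [pow_pos hκ0 3]
    · refine mul_le_mul_of_nonneg_right ?_ (by positivity)
      rw [le_div_iff₀ hω']
      nlinarith
  induction n with
  | zero =>
    intro r hr hrR hRr
    exact hlast r hr hrR (by simpa using hRr)
  | succ n ih =>
    intro r hr hrR hRr y hy hyA hyT
    rcases lt_or_ge R₀ (2 * r) with h2r | h2r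
    · exact hlast r hr hrR h2r y hy hyA hyT
    obtain ⟨w, hw, hwA, hwT⟩ := hgood x hx (2 * r) (by positivity) h2r
    have h1 := ih (2 * r) (by positivity) h2r (by rw [pow_succ] at hRr; linarith) w hw hwA hwT
    have hyw : ρ y w < κ ^ 2 * (2 * r) :=
      h.isQuasiBound.lt_of_mem_qball (lt_trans (show ρ x y < r from hy) (by linarith)) hw
    have h2 := hnear r hr y w hyA hwA (2 * r) (by linarith)
      (hyw.trans_le (le_trans (by nlinarith [pow_pos hκ0 4]) hk.le))
      (hyw.le.trans (by nlinarith)) hyT hwT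
    have h3 : W * (2 * r) ^ (ε - Q / p) ≤ ω * (W * r ^ (ε - Q / p)) := by
      rw [Real.mul_rpow zero_le_two hr.le, hω_def]
      have : (2 : ℝ) ^ (ε - Q / p) ≤ (2 : ℝ) ^ (-δ) :=
        Real.rpow_le_rpow_of_exponent_le one_le_two (by linarith)
      calc _ = (2 : ℝ) ^ (ε - Q / p) * (W * r ^ (ε - Q / p)) := by ring
        _ ≤ _ := by gcongr
    calc |u y - u z| ≤ |u y - u w| + |u w - u z| := abs_sub_le _ _ _
      _ ≤ c * (W * r ^ (ε - Q / p)) + c / (1 - ω) * (ω * (W * r ^ (ε - Q / p))) :=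
          add_le_add h2 (h1.trans (mul_le_mul_of_nonneg_left h3 (by positivity)))
      -- The identity `c + ω * c / (1 - ω) = c / (1 - ω)` closes the induction with a constant free
      -- of `n`.
      _ = c / (1 - ω) * (W * r ^ (ε - Q / p)) := by field_simp; ring

/-- The pointwise estimate behind the Sobolev–Poincaré inequality. -/
theorem HasBoundedGradient.abs_sub_rpow_le
    (h : HasBoundedGradient ρ μ κ x₀ R₀ σ s p Q b M u g E) {ε δ : ℝ} (hε : 0 < ε) (hεs : ε < s)
    (hδ : 0 < δ) (hQ : ε + δ ≤ Q / p) {pstar : ℝ} (hps0 : 0 < pstar)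
    (hps1 : p / pstar = 1 - ε * p / Q) {k : ℤ} (hk : 4 * κ ^ 4 * R₀ < (2 : ℝ) ^ (-k)) {W t : ℝ}
    (hW : 0 < W) (ht_def : t = W * R₀ ^ (-(Q / p)))
    (hgood : ∀ x ∈ qball ρ x₀ R₀, ∀ r, 0 < r → r ≤ R₀ → ∃ y ∈ qball ρ x r,
      y ∈ qball ρ x₀ (σ * R₀) \ E ∧ tailGrad p (s - ε) g k y ≤ ENNReal.ofReal (W * r ^ (-(Q / p))))
    {z : X} (hz : z ∈ qball ρ x₀ R₀) (hzA : z ∈ qball ρ x₀ (σ * R₀) \ E)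
    (hzT : tailGrad p (s - ε) g k z ≤ ENNReal.ofReal t)
    {x : X} (hx : x ∈ qball ρ x₀ R₀) (hxE : x ∉ E) (hxT : tailGrad p (s - ε) g k x ≠ ∞) :
    |u x - u z| ^ pstar ≤ ((2 + 2 * (2 * κ ^ 3) ^ ε / (1 - (2 : ℝ) ^ (-δ))) * (R₀ ^ ε * t)) ^ pstar *
      (1 + (t ^ p)⁻¹ * (tailGrad p (s - ε) g k x).toReal ^ p) := by
  have hκ := h.isQuasiBound.one_le
  have hκ0 := h.kappa_pos
  have hR := h.radius_pos
  have hp := h.p_pos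
  have hQp := h.Q_pos
  have ht : 0 < t := by rw [ht_def]; positivity
  set c : ℝ := 2 * (2 * κ ^ 3) ^ ε / (1 - (2 : ℝ) ^ (-δ)) with hc_def
  have hω1 := two_rpow_neg_lt_one hδ
  have hω' : 0 < 1 - (2 : ℝ) ^ (-δ) := by linarith
  have hc : 0 < c := by positivity
  have hcc : 2 * (κ ^ 2) ^ ε ≤ c := by
    rw [hc_def, le_div_iff₀ hω']
    have h1 : (κ ^ 2) ^ ε ≤ (2 * κ ^ 3) ^ ε := by
      refine Real.rpow_le_rpow (by positivity) ?_ hε.le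
      nlinarith [pow_pos hκ0 3, pow_le_pow_right₀ hκ (show 2 ≤ 3 by norm_num)]
    have h2 : 0 < (κ ^ 2) ^ ε := by positivity
    have h3 : (0 : ℝ) < (2 : ℝ) ^ (-δ) := by positivity
    nlinarith
  set S : ℝ := (2 + c) * (R₀ ^ ε * t) with hS_def
  have hS : 0 < S := by positivity
  set H := (tailGrad p (s - ε) g k x).toReal with hH_def
  have hH0 : 0 ≤ H := ENNReal.toReal_nonneg
  have hxA : x ∈ qball ρ x₀ (σ * R₀) \ E := ⟨h.subset_dilate hx, hxE⟩
  have hxH : tailGrad p (s - ε) g k x ≤ ENNReal.ofReal H := (ENNReal.ofReal_toReal hxT).ge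
  rcases le_or_gt H t with hHt | hHt
  · have hxz := h.isQuasiBound.lt_of_mem_qball hx hz
    have h1 := h.abs_sub_le_of_tailGrad_le hε.le hεs.le hxA hzA
      (hxz.trans_le (le_trans (by
        nlinarith [mul_le_mul_of_nonneg_right
          (pow_le_pow_right₀ hκ (show 2 ≤ 4 by norm_num)) hR.le, pow_pos hκ0 4]) hk.le))
      hH0 ht.le hxH hzT hxz.le
    have h2 : |u x - u z| ≤ S := by
      refine h1.trans ?_
      rw [Real.mul_rpow (by positivity) hR.le, hS_def]
      have h3 : 0 ≤ (κ ^ 2) ^ ε * R₀ ^ ε := by positivity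
      have h4 : 0 ≤ R₀ ^ ε * t := by positivity
      nlinarith
    refine (Real.rpow_le_rpow (abs_nonneg _) h2 hps0.le).trans ?_
    refine le_mul_of_one_le_right (by positivity) ?_
    have : 0 ≤ (t ^ p)⁻¹ * H ^ p := by positivity
    linarith
  · have hHpos : 0 < H := ht.trans hHt
    -- Hedberg's choice: `r` solves `W * r ^ (-(Q / p)) = H`, so a good point of `B_ρ(x, r)` has
    -- tail at most that of `x`.
    set r : ℝ := R₀ * (t / H) ^ (p / Q) with hr_def
    have hq1 : t / H < 1 := (div_lt_one hHpos).2 hHt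
    have hq0 : 0 < t / H := by positivity
    have hr : 0 < r := by positivity
    have hrR : r ≤ R₀ :=
      mul_le_of_le_one_right hR.le (Real.rpow_le_one hq0.le hq1.le (by positivity))
    have hWr : W * r ^ (-(Q / p)) = H := by
      have e : p / Q * -(Q / p) = -1 := by field_simp
      rw [hr_def, Real.mul_rpow hR.le (by positivity), ← Real.rpow_mul hq0.le, e,
        Real.rpow_neg_one, ← mul_assoc, ← ht_def]
      field_simp
    obtain ⟨y, hy, hyA, hyT⟩ := hgood x hx r hr hrR
    obtain ⟨n, hn⟩ := pow_unbounded_of_one_lt (R₀ / r) (one_lt_two (α := ℝ))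
    have hn' : R₀ < 2 ^ (n + 1) * r := by
      rw [div_lt_iff₀ hr] at hn
      rw [pow_succ]
      nlinarith [pow_pos (two_pos (α := ℝ)) n, mul_pos (pow_pos (two_pos (α := ℝ)) n) hr]
    have h1 := h.abs_sub_le_of_chain hε hεs hδ hQ hk hW hgood hz hzA (ht_def ▸ hzT) hx n r hr hrR hn' y hy
      hyA hyT
    have hxy : ρ x y < r := hy
    have h2 := h.abs_sub_le_of_tailGrad_le hε.le hεs.le hxA hyA
      (hxy.trans_le (hrR.trans (le_trans (by nlinarith [one_le_pow₀ hκ (n := 4)]) hk.le)))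
      hH0 hH0 hxH (hWr ▸ hyT) hxy.le
    have h3 : W * r ^ (ε - Q / p) = r ^ ε * H := by
      rw [← hWr, sub_eq_add_neg, Real.rpow_add hr]
      ring
    -- Here `p*` is forced: `r ^ ε * H` is proportional to `H ^ (1 - ε * p / Q)`, whose `p*`-th
    -- power is `H ^ p`.
    have h4 : r ^ ε * H = R₀ ^ ε * t * (H / t) ^ (p / pstar) := by
      rw [hr_def, Real.mul_rpow hR.le (by positivity), ← Real.rpow_mul hq0.le, hps1,
        Real.rpow_sub (by positivity), Real.rpow_one, ← inv_div H t,
        Real.inv_rpow (by positivity), show p / Q * ε = ε * p / Q by ring]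
      field_simp
    have h5 : |u x - u z| ≤ S * (H / t) ^ (p / pstar) := by
      refine (abs_sub_le _ (u y) _).trans ?_
      rw [h3] at h1
      calc _ ≤ r ^ ε * (H + H) + c * (r ^ ε * H) := add_le_add h2 h1
        _ = (2 + c) * (r ^ ε * H) := by ring
        _ = _ := by rw [h4, hS_def]; ring
    refine (Real.rpow_le_rpow (abs_nonneg _) h5 hps0.le).trans ?_
    rw [Real.mul_rpow hS.le (by positivity), ← Real.rpow_mul (by positivity),
      div_mul_cancel₀ _ hps0.ne', Real.div_rpow hH0 ht.le]
    refine mul_le_mul_of_nonneg_left ?_ (by positivity)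
    rw [div_eq_inv_mul]
    linarith

theorem HasBoundedGradient.exists_laverage_le
    (h : HasBoundedGradient ρ μ κ x₀ R₀ σ s p Q b M u g E) {ε δ : ℝ} (hε : 0 < ε) (hεs : ε < s)
    (hδ : 0 < δ) (hQ : ε + δ ≤ Q / p) {pstar : ℝ} (hps : pstar = Q * p / (Q - ε * p)) :
    ∃ γ : ℝ, (⨍⁻ x in qball ρ x₀ R₀, ‖u x - γ‖ₑ ^ pstar ∂μ) ^ (1 / pstar) ≤
      ENNReal.ofReal (2 ^ (1 / p) * sobolevConst κ s p ε δ * b ^ (-1 / p) * R₀ ^ (s - Q / p) * M) := by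
  have hκ := h.isQuasiBound.one_le
  have hκ0 := h.kappa_pos
  have hR := h.radius_pos
  have hp := h.p_pos
  have hb := h.b_pos
  have hM := h.M_pos
  have hQp := h.Q_pos
  have ha : 0 < s - ε := sub_pos.2 hεs
  have hT := tailConst_pos hp ha
  have hεQ : ε * p < Q := by
    have : ε < Q / p := by linarith
    rwa [lt_div_iff₀ hp] at this
  have hQε : 0 < Q - ε * p := by linarith
  have hps0 : 0 < pstar := by rw [hps]; positivity
  have hps1 : p / pstar = 1 - ε * p / Q := by rw [hps]; field_simp
  have hpps : p ≤ pstar := by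
    rw [hps, le_div_iff₀ hQε]
    nlinarith [mul_pos hε hp]
  obtain ⟨k, hk, hk'⟩ := exists_int_two_zpow_neg (x := 4 * κ ^ 4 * R₀) (by positivity)
  have hk'' : (2 : ℝ) ^ (-k) ≤ 8 * κ ^ 4 * R₀ := by linarith
  set K : ℝ := tailConst p (s - ε) * (8 * κ ^ 4 * R₀) ^ (s - ε) * M with hK_def
  have hK : 0 < K := by positivity
  set W : ℝ := K * b ^ (-1 / p) with hW_def
  have hW : 0 < W := by positivity
  have hgood : ∀ x ∈ qball ρ x₀ R₀, ∀ r, 0 < r → r ≤ R₀ → ∃ y ∈ qball ρ x r,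
      y ∈ qball ρ x₀ (σ * R₀) \ E ∧
        tailGrad p (s - ε) g k y ≤ ENNReal.ofReal (W * r ^ (-(Q / p))) :=
    fun x hx r hr hrR => h.exists_tailGrad_le ha hx hr hrR hk''
  obtain ⟨z, hz, hzA, hzT⟩ := hgood x₀ h.center_mem R₀ hR le_rfl
  set t : ℝ := W * R₀ ^ (-(Q / p)) with ht_def
  have ht : 0 < t := by positivity
  set c : ℝ := 2 * (2 * κ ^ 3) ^ ε / (1 - (2 : ℝ) ^ (-δ)) with hc_def
  have hω1 := two_rpow_neg_lt_one hδ
  have hω' : 0 < 1 - (2 : ℝ) ^ (-δ) := by linarith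
  have hc : 0 < c := by positivity
  set S : ℝ := (2 + c) * (R₀ ^ ε * t) with hS_def
  have hS : 0 < S := by positivity
  have hcore : ∀ x ∈ qball ρ x₀ R₀, x ∉ E → tailGrad p (s - ε) g k x ≠ ∞ →
      |u x - u z| ^ pstar ≤
        S ^ pstar * (1 + (t ^ p)⁻¹ * (tailGrad p (s - ε) g k x).toReal ^ p) :=
    fun x hx hxE hxT =>
      h.abs_sub_rpow_le hε hεs hδ hQ hps0 hps1 hk hW ht_def hgood hz hzA hzT hx hxE hxT
  have hμB := h.ofReal_le_measure h.center_mem hR le_rfl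
  have hμ0 : μ (qball ρ x₀ R₀) ≠ 0 := (h.isBallMeasure.ball_pos x₀ R₀ hR).ne'
  have hμt : μ (qball ρ x₀ R₀) ≠ ∞ := (h.isBallMeasure.ball_lt_top x₀ R₀ hR).ne
  -- As `t` is the Markov bound at scale `R₀`, the mean of `(tailGrad / t) ^ p` over `B₀` is at most
  -- 1.
  have hint : ∫⁻ x in qball ρ x₀ R₀, tailGrad p (s - ε) g k x ^ p ∂μ ≤
      ENNReal.ofReal (t ^ p) * μ (qball ρ x₀ R₀) := by
    refine (lintegral_mono_set h.subset_dilate).trans ((h.lintegral_tailGrad_lt ha k).le.trans ?_)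
    refine le_trans ?_ (mul_le_mul_right hμB _)
    rw [← ENNReal.ofReal_mul (by positivity)]
    refine ENNReal.ofReal_le_ofReal ?_
    have e1 : t ^ p * (b * R₀ ^ Q) = K ^ p := by
      rw [ht_def, hW_def, Real.mul_rpow (by positivity) (by positivity),
        Real.mul_rpow hK.le (by positivity), ← Real.rpow_mul hb.le, ← Real.rpow_mul hR.le,
        div_mul_cancel₀ _ hp.ne', neg_mul, div_mul_cancel₀ _ hp.ne', Real.rpow_neg_one,
        Real.rpow_neg hR.le]
      field_simp
    rw [e1]
    refine Real.rpow_le_rpow (by positivity) ?_ hp.le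
    rw [hK_def]
    have e2 : (2 : ℝ) ^ (-(k : ℝ) * (s - ε)) ≤ (8 * κ ^ 4 * R₀) ^ (s - ε) := by
      rw [Real.rpow_mul (by norm_num)]
      refine Real.rpow_le_rpow (by positivity) ?_ ha.le
      have : (2 : ℝ) ^ (-(k : ℝ)) = (2 : ℝ) ^ (-k) := by
        rw [← Real.rpow_intCast]; push_cast; rfl
      rwa [this]
    gcongr
  have hmain : ∫⁻ x in qball ρ x₀ R₀, ‖u x - u z‖ₑ ^ pstar ∂μ ≤
      2 * ENNReal.ofReal (S ^ pstar) * μ (qball ρ x₀ R₀) := by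
    calc _ ≤ ∫⁻ x in qball ρ x₀ R₀, ENNReal.ofReal (S ^ pstar) *
          (1 + ENNReal.ofReal ((t ^ p)⁻¹) * tailGrad p (s - ε) g k x ^ p) ∂μ := by
          refine lintegral_mono_ae ?_
          filter_upwards [h.ae_tailGrad_ne_top ha k] with x ⟨hx, hxE, hxT⟩
          rw [Real.enorm_eq_ofReal_abs, ENNReal.ofReal_rpow_of_nonneg (abs_nonneg _) hps0.le]
          refine (ENNReal.ofReal_le_ofReal (hcore x hx hxE hxT)).trans_eq ?_
          rw [ENNReal.ofReal_mul (by positivity), ENNReal.ofReal_add zero_le_one (by positivity),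
            ENNReal.ofReal_mul (by positivity), ENNReal.ofReal_one,
            ← ENNReal.ofReal_rpow_of_nonneg ENNReal.toReal_nonneg hp.le,
            ENNReal.ofReal_toReal hxT]
      _ = ENNReal.ofReal (S ^ pstar) * (μ (qball ρ x₀ R₀) + ENNReal.ofReal ((t ^ p)⁻¹) *
          ∫⁻ x in qball ρ x₀ R₀, tailGrad p (s - ε) g k x ^ p ∂μ) := by
          rw [lintegral_const_mul' _ _ ENNReal.ofReal_ne_top,
            lintegral_add_left measurable_const, setLIntegral_const, one_mul,
            lintegral_const_mul' _ _ ENNReal.ofReal_ne_top]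
      _ ≤ ENNReal.ofReal (S ^ pstar) * (μ (qball ρ x₀ R₀) + ENNReal.ofReal ((t ^ p)⁻¹) *
          (ENNReal.ofReal (t ^ p) * μ (qball ρ x₀ R₀))) := by gcongr
      _ = _ := by
          rw [← mul_assoc (ENNReal.ofReal ((t ^ p)⁻¹)), ← ENNReal.ofReal_mul (by positivity),
            inv_mul_cancel₀ (by positivity), ENNReal.ofReal_one]
          ring
  refine ⟨u z, ?_⟩
  rw [setLAverage_eq, one_div, ENNReal.rpow_inv_le_iff hps0]
  refine (ENNReal.div_le_of_le_mul hmain).trans ?_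
  have hSe : S = sobolevConst κ s p ε δ * b ^ (-1 / p) * R₀ ^ (s - Q / p) * M := by
    have : R₀ ^ (s - Q / p) = R₀ ^ (s - ε) * (R₀ ^ ε * R₀ ^ (-(Q / p))) := by
      rw [← Real.rpow_add hR, ← Real.rpow_add hR]
      congr 1
      ring
    rw [this, hS_def, ht_def, hW_def, hK_def, sobolevConst, ← hc_def,
      Real.mul_rpow (by positivity) hR.le]
    ring
  have : 2 ^ (1 / p) * sobolevConst κ s p ε δ * b ^ (-1 / p) * R₀ ^ (s - Q / p) * M
      = 2 ^ (1 / p) * S := by rw [hSe]; ring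
  rw [this, ENNReal.ofReal_rpow_of_nonneg (by positivity) hps0.le,
    Real.mul_rpow (by positivity) hS.le, ENNReal.ofReal_mul (by positivity)]
  gcongr
  -- The leftover factor 2 is at most `2 ^ (pstar / p)` because `p ≤ pstar`, so no dependence on `Q`
  -- enters.
  rw [← Real.rpow_mul zero_le_two, ← ENNReal.ofReal_ofNat]
  refine ENNReal.ofReal_le_ofReal ?_
  refine (Real.rpow_one (2 : ℝ)).symm.trans_le (Real.rpow_le_rpow_of_exponent_le one_le_two ?_)
  rw [one_div, inv_mul_eq_div, le_div_iff₀ hp]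
  linarith

end

/-! ### Averages -/

theorem laverage_rpow_eq_eLpNorm [MeasurableSpace X] (μ : Measure X) (B : Set X) {r : ℝ}
    (hr : 0 < r) (f : X → ℝ) :
    (⨍⁻ x in B, ‖f x‖ₑ ^ r ∂μ) ^ (1 / r) =
      eLpNorm f (ENNReal.ofReal r) ((μ B)⁻¹ • μ.restrict B) := by
  rw [eLpNorm_eq_lintegral_rpow_enorm_toReal (by simpa using hr) ENNReal.ofReal_ne_top,
    ENNReal.toReal_ofReal hr.le, setLAverage_eq']

theorem LpAddConst_ofReal_le {p r : ℝ} (hp : 0 < p) (hpr : p ≤ r) :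
    ENNReal.LpAddConst (ENNReal.ofReal r) ≤ ENNReal.ofReal (2 ^ (1 / p)) := by
  have hr : 0 < r := hp.trans_le hpr
  have h1 : (1 : ℝ) ≤ 2 ^ (1 / p) := Real.one_le_rpow one_le_two (by positivity)
  unfold ENNReal.LpAddConst
  split_ifs
  · rw [ENNReal.toReal_ofReal hr.le, ← ENNReal.ofReal_ofNat, ENNReal.ofReal_rpow_of_pos two_pos]
    refine ENNReal.ofReal_le_ofReal (Real.rpow_le_rpow_of_exponent_le one_le_two ?_)
    have := one_div_le_one_div_of_le hp hpr
    linarith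
  · rw [← ENNReal.ofReal_one]
    exact ENNReal.ofReal_le_ofReal h1

/-- On a probability space, the `L^r` norm of `u` is controlled by its `L^p` norm and the distance
of `u` to the constants in `L^r`. -/
theorem eLpNorm_le_of_sub_const [MeasurableSpace X] {ν : Measure X} [IsProbabilityMeasure ν]
    {p r : ℝ} (hp : 0 < p) (hpr : p ≤ r) {u : X → ℝ} (hu : AEStronglyMeasurable u ν) (γ : ℝ) :
    eLpNorm u (ENNReal.ofReal r) ν ≤ ENNReal.ofReal (2 * (2 ^ (1 / p)) ^ 2) *
      (eLpNorm (fun x => u x - γ) (ENNReal.ofReal r) ν + eLpNorm u (ENNReal.ofReal p) ν) := by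
  have hr : 0 < r := hp.trans_le hpr
  set c : ℝ≥0∞ := ENNReal.ofReal (2 ^ (1 / p)) with hc_def
  have hc1 : 1 ≤ c := by
    rw [hc_def, ← ENNReal.ofReal_one]
    exact ENNReal.ofReal_le_ofReal (Real.one_le_rpow one_le_two (by positivity))
  have hd : AEStronglyMeasurable (fun x => u x - γ) ν := hu.sub aestronglyMeasurable_const
  have hconst : ∀ t : ℝ, 0 < t → eLpNorm (fun _ : X => γ) (ENNReal.ofReal t) ν = ‖γ‖ₑ := by
    intro t ht
    rw [eLpNorm_const' _ (by simpa using ht) ENNReal.ofReal_ne_top]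
    simp
  set D := eLpNorm (fun x => u x - γ) (ENNReal.ofReal r) ν with hD_def
  set U := eLpNorm u (ENNReal.ofReal p) ν with hU_def
  have h1 : eLpNorm u (ENNReal.ofReal r) ν ≤ c * (D + ‖γ‖ₑ) := by
    have h := eLpNorm_add_le' hd (aestronglyMeasurable_const (b := γ)) (ENNReal.ofReal r)
    have e : ((fun x => u x - γ) + fun _ => γ) = u := by ext x; simp
    rw [e, hconst r hr] at h
    exact h.trans (mul_le_mul_left (LpAddConst_ofReal_le hp hpr) _)
  -- The constant is measured in `L^p` by writing `γ = (γ - u) + u`; `L^r` dominates `L^p` on a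
  -- probability space.
  have h2 : ‖γ‖ₑ ≤ c * (D + U) := by
    have h := eLpNorm_add_le' (hd.neg) hu (ENNReal.ofReal p)
    have e : (-(fun x => u x - γ) + u) = fun _ => γ := by ext x; simp
    rw [e, hconst p hp, eLpNorm_neg] at h
    refine h.trans (mul_le_mul' (LpAddConst_ofReal_le hp le_rfl) (add_le_add_left ?_ _))
    exact eLpNorm_le_eLpNorm_of_exponent_le (ENNReal.ofReal_le_ofReal hpr) hd
  calc _ ≤ c * (D + c * (D + U)) := h1.trans (by gcongr)
    _ ≤ c * (c * (D + U) + c * (D + U)) := by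
        gcongr
        calc D ≤ 1 * (D + U) := by rw [one_mul]; exact le_self_add
          _ ≤ _ := by gcongr
    _ = _ := by
        rw [ENNReal.ofReal_mul zero_le_two, ENNReal.ofReal_pow (by positivity), ← hc_def]
        simp only [ENNReal.ofReal_ofNat]
        ring

/-- Consequences of a bound on the oscillation of a representative of `u` on `B`. -/
theorem integrableOn_and_ae_abs_sub_average_le [MeasurableSpace X] {μ : Measure X} {B : Set X}
    (hB : NullMeasurableSet B μ) (h0 : μ B ≠ 0) (ht : μ B ≠ ∞) {u v : X → ℝ}
    (hu : AEMeasurable u (μ.restrict B)) (hvu : v =ᵐ[μ.restrict B] u) {S : ℝ}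
    (hS : ∀ x ∈ B, ∀ y ∈ B, |v x - v y| ≤ S) :
    IntegrableOn u B μ ∧ ∀ᵐ x ∂μ.restrict B, |u x - ⨍ y in B, u y ∂μ| ≤ S := by
  obtain ⟨x₀, hx₀⟩ := nonempty_of_measure_ne_zero h0
  have hmem : ∀ᵐ x ∂μ.restrict B, x ∈ B := ae_restrict_mem₀ hB
  have hosc : ∀ x ∈ B, ∀ᵐ y ∂μ.restrict B, u y ∈ Metric.closedBall (v x) S := by
    intro x hx
    filter_upwards [hvu, hmem] with y hy hyB
    rw [← hy, Metric.mem_closedBall, Real.dist_eq]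
    exact hS y hyB x hx
  have hint : IntegrableOn u B μ := by
    have : Fact (μ B < ∞) := ⟨ht.lt_top⟩
    refine Integrable.of_bound hu.aestronglyMeasurable (|v x₀| + S) ?_
    filter_upwards [hosc x₀ hx₀] with y hy
    rw [Metric.mem_closedBall, Real.dist_eq] at hy
    rw [Real.norm_eq_abs]
    have := abs_sub_abs_le_abs_sub (u y) (v x₀)
    linarith
  refine ⟨hint, ?_⟩
  filter_upwards [hvu, hmem] with x hx hxB
  -- Almost all values of `u` lie in the closed interval of radius `S` about `v x`; by convexity so
  -- does their average.
  have := (convex_closedBall (v x) S).set_average_mem Metric.isClosed_closedBall h0 ht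
    (hosc x hxB) hint
  rwa [Metric.mem_closedBall, dist_comm, Real.dist_eq, hx] at this

/-- Gradients are available only for bounds `M` strictly above the seminorm, as the infimum need not
be attained; this passes to the limit, also when `N = 0`. -/
theorem le_mul_add_of_forall_lt_ofReal {a c d N : ℝ≥0∞} (hN : N ≠ ∞) (hc : c ≠ ∞)
    (h : ∀ M : ℝ, N < ENNReal.ofReal M → a ≤ c * ENNReal.ofReal M + d) : a ≤ c * N + d := by
  have h1 : Filter.Tendsto (fun M : ℝ => c * ENNReal.ofReal M + d)
      (nhdsWithin N.toReal (Ioi N.toReal)) (nhds (c * N + d)) := by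
    have h2 : Filter.Tendsto ENNReal.ofReal (nhdsWithin N.toReal (Ioi N.toReal)) (nhds N) := by
      have := ENNReal.continuous_ofReal.tendsto N.toReal
      rw [ENNReal.ofReal_toReal hN] at this
      exact this.mono_left nhdsWithin_le_nhds
    exact (ENNReal.Tendsto.const_mul h2 (Or.inr hc)).add_const d
  refine ge_of_tendsto h1 ?_
  filter_upwards [self_mem_nhdsWithin] with M hM
  exact h M ((ENNReal.lt_ofReal_iff_toReal_lt hN).2 hM)

/-! ### The embedding theorem -/

/-- The oscillation of the Hölder representative on the whole ball. -/
theorem HasBoundedGradient.exists_holder_of_le [MeasurableSpace X] {ρ : X → X → ℝ} {μ : Measure X}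
    {κ : ℝ} {x₀ : X} {R₀ σ s p Q b M : ℝ} {u : X → ℝ} {g : ℤ → X → ℝ≥0} {E : Set X}
    (h : HasBoundedGradient ρ μ κ x₀ R₀ σ s p Q b M u g E) {η C : ℝ} (hη : η < s)
    (hQ : Q / p ≤ η) (hC : (κ ^ 2) ^ s * holderConst κ s p η ≤ C) :
    ∃ v : X → ℝ, v =ᵐ[μ.restrict (qball ρ x₀ R₀)] u ∧
      (∀ x ∈ qball ρ x₀ R₀, ∀ y ∈ qball ρ x₀ R₀,
        |v x - v y| ≤ C * b ^ (-1 / p) * ρ x y ^ (s - Q / p) * M) ∧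
      ∀ x ∈ qball ρ x₀ R₀, ∀ y ∈ qball ρ x₀ R₀,
        |v x - v y| ≤ C * b ^ (-1 / p) * R₀ ^ (s - Q / p) * M := by
  obtain ⟨v, hvu, hv⟩ := h.exists_holder hη hQ
  have hκ := h.isQuasiBound.one_le
  have hκ0 := h.kappa_pos
  have hs := h.s_pos
  have hb := h.b_pos
  have hR := h.radius_pos
  have hM := h.M_pos
  have hH := holderConst_pos hκ0 hs h.p_pos hη
  have hκ2 : 1 ≤ κ ^ 2 := one_le_pow₀ hκ
  have hκs : 1 ≤ (κ ^ 2) ^ s := Real.one_le_rpow hκ2 hs.le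
  have hQp : 0 ≤ Q / p := div_nonneg h.Q_pos.le h.p_pos.le
  refine ⟨v, hvu, fun x hx y hy => (hv x hx y hy).trans ?_, fun x hx y hy =>
    (hv x hx y hy).trans ?_⟩
  · have := h.isQuasiMetric.nonneg x y
    have : holderConst κ s p η ≤ C := (le_mul_of_one_le_left hH.le hκs).trans hC
    gcongr
  · have h1 : ρ x y ^ (s - Q / p) ≤ (κ ^ 2) ^ s * R₀ ^ (s - Q / p) := by
      refine (Real.rpow_le_rpow (h.isQuasiMetric.nonneg x y)
        (h.isQuasiBound.lt_of_mem_qball hx hy).le (by linarith)).trans ?_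
      rw [Real.mul_rpow (by positivity) hR.le]
      gcongr
      linarith
    calc _ ≤ holderConst κ s p η * b ^ (-1 / p) * ((κ ^ 2) ^ s * R₀ ^ (s - Q / p)) * M := by gcongr
      _ = (κ ^ 2) ^ s * holderConst κ s p η * b ^ (-1 / p) * R₀ ^ (s - Q / p) * M := by ring
      _ ≤ _ := by gcongr

/-! ### Constants uniform in `Q` -/

/-- The constant in the Sobolev–Poincaré and Hölder estimates on the ball. -/
noncomputable def embeddingConst (κ s p ε : ℝ) : ℝ :=
  (κ ^ 2) ^ s * holderConst κ s p ((s + ε) / 2) +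
    2 ^ (1 / p) * sobolevConst κ s p ε ((s - ε) / 2) + 1

theorem HasBoundedGradient.exists_laverage_le_embeddingConst [MeasurableSpace X] {ρ : X → X → ℝ}
    {μ : Measure X} {κ : ℝ} {x₀ : X} {R₀ σ s p Q b M : ℝ} {u : X → ℝ} {g : ℤ → X → ℝ≥0} {E : Set X}
    (h : HasBoundedGradient ρ μ κ x₀ R₀ σ s p Q b M u g E) {ε : ℝ} (hε : 0 < ε) (hεs : ε < s)
    (hQ : ε * p < Q) {pstar : ℝ} (hps : pstar = Q * p / (Q - ε * p)) :
    ∃ γ : ℝ, (⨍⁻ x in qball ρ x₀ R₀, ‖u x - γ‖ₑ ^ pstar ∂μ) ^ (1 / pstar) ≤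
      ENNReal.ofReal (embeddingConst κ s p ε * b ^ (-1 / p) * R₀ ^ (s - Q / p) * M) := by
  have hκ0 := h.kappa_pos
  have hs := h.s_pos
  have hp := h.p_pos
  have hb := h.b_pos
  have hR := h.radius_pos
  have hM := h.M_pos
  have hH := holderConst_pos (κ := κ) hκ0 hs hp (show (s + ε) / 2 < s by linarith)
  have hS := sobolevConst_pos (κ := κ) hκ0 hp hεs (show 0 < (s - ε) / 2 by linarith)
  rcases le_or_gt (Q / p) ((s + ε) / 2) with hle | hgt
  -- For `Q/p` close to `ε` the chaining constant would blow up, so the bounded oscillation of `v`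
  -- is used instead, with `γ = v x₀`.
  · obtain ⟨v, hvu, -, hv⟩ := h.exists_holder_of_le (η := (s + ε) / 2) (by linarith) hle le_rfl
    refine ⟨v x₀, ?_⟩
    have hps0 : 0 < pstar := by
      rw [hps]
      exact div_pos (mul_pos h.Q_pos hp) (by linarith)
    have hμ0 : μ (qball ρ x₀ R₀) ≠ 0 := (h.isBallMeasure.ball_pos x₀ R₀ hR).ne'
    have hμt : μ (qball ρ x₀ R₀) ≠ ∞ := (h.isBallMeasure.ball_lt_top x₀ R₀ hR).ne
    set S := (κ ^ 2) ^ s * holderConst κ s p ((s + ε) / 2) * b ^ (-1 / p) * R₀ ^ (s - Q / p) * M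
      with hS_def
    have hS0 : 0 < S := by positivity
    have h1 : ⨍⁻ x in qball ρ x₀ R₀, ‖u x - v x₀‖ₑ ^ pstar ∂μ ≤ ENNReal.ofReal S ^ pstar := by
      rw [setLAverage_eq]
      refine ENNReal.div_le_of_le_mul ?_
      rw [← setLIntegral_const]
      refine lintegral_mono_ae ?_
      filter_upwards [hvu, ae_restrict_mem₀ (h.isBallMeasure.nullMeasurable_ball _ _ hR)] with x
        hx hxB
      rw [Real.enorm_eq_ofReal_abs, ← hx]
      have := hv x hxB x₀ h.center_mem
      gcongr
    rw [one_div, ENNReal.rpow_inv_le_iff hps0]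
    refine h1.trans (ENNReal.rpow_le_rpow (ENNReal.ofReal_le_ofReal ?_) hps0.le)
    rw [hS_def, embeddingConst]
    gcongr
    have : 0 < (2 : ℝ) ^ (1 / p) * sobolevConst κ s p ε ((s - ε) / 2) := by positivity
    linarith
  · obtain ⟨γ, hγ⟩ := h.exists_laverage_le hε hεs (δ := (s - ε) / 2) (by linarith) (by linarith) hps
    refine ⟨γ, hγ.trans (ENNReal.ofReal_le_ofReal ?_)⟩
    rw [embeddingConst]
    gcongr
    have : 0 < (κ ^ 2) ^ s * holderConst κ s p ((s + ε) / 2) := by positivity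
    linarith

theorem eLpNorm_normalized_le [MeasurableSpace X] {μ : Measure X} {A B : Set X} (hBA : B ⊆ A)
    {b R Q p : ℝ} (hb : 0 < b) (hR : 0 < R) (hp : 0 < p) (hB : ENNReal.ofReal (b * R ^ Q) ≤ μ B)
    (u : X → ℝ) :
    eLpNorm u (ENNReal.ofReal p) ((μ B)⁻¹ • μ.restrict B) ≤
      ENNReal.ofReal (b ^ (-1 / p) * R ^ (-Q / p)) *
        eLpNorm u (ENNReal.ofReal p) (μ.restrict A) := by
  rw [eLpNorm_smul_measure_of_ne_top ENNReal.ofReal_ne_top, smul_eq_mul]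
  refine mul_le_mul' ?_ (eLpNorm_mono_measure u (Measure.restrict_mono hBA le_rfl))
  have e : (1 / ENNReal.ofReal p).toReal = 1 / p := by
    rw [one_div, ENNReal.toReal_inv, ENNReal.toReal_ofReal hp.le, one_div]
  have e2 : b ^ (-1 / p) * R ^ (-Q / p) = ((b * R ^ Q)⁻¹) ^ (1 / p) := by
    rw [Real.inv_rpow (by positivity), ← Real.rpow_neg (by positivity),
      Real.mul_rpow hb.le (by positivity), ← Real.rpow_mul hR.le]
    congr 2 <;> ring
  rw [e, e2, ← ENNReal.ofReal_rpow_of_pos (by positivity),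
    ENNReal.ofReal_inv_of_pos (by positivity)]
  exact ENNReal.rpow_le_rpow (ENNReal.inv_le_inv.2 hB) (by positivity)

end HajlaszBesov

/-! ### Assembly of the three cases -/

open HajlaszBesov in
theorem mainTheorem6 {X : Type*} [Nontrivial X] (ρ : X → X → ℝ)
    (hρ : HajlaszBesov.IsQuasiMetric ρ)
    (s p σ ε : ℝ) (hs : 0 < s) (hp : 0 < p) (hσ : HajlaszBesov.quasiConst ρ ≤ σ)
    (hε : 0 < ε) (hεs : ε < s) :
    ∃ C C₁ C₂ : ℝ, 0 < C ∧ 0 < C₁ ∧ 0 < C₂ ∧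
      ∀ [MeasurableSpace X] (μ : Measure X), HajlaszBesov.IsBallMeasure ρ μ →
      ∀ (q : ℝ≥0∞), 0 < q →
      ∀ (x₀ : X) (R₀ : ℝ), 0 < R₀ →
      ∀ (Q b : ℝ), 0 < Q → 0 < b → HajlaszBesov.VCondition ρ μ x₀ R₀ σ Q b →
      ∀ (B₀ σB₀ : Set X), B₀ = HajlaszBesov.qball ρ x₀ R₀ →
        σB₀ = HajlaszBesov.qball ρ x₀ (σ * R₀) →
      ∀ u : X → ℝ, HajlaszBesov.MemBesov ρ μ σB₀ s p q u →
      ∀ N : ℝ≥0∞, N = HajlaszBesov.besovSeminorm ρ μ σB₀ s p q u →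
        (p < Q / ε → ∀ pstar : ℝ, pstar = Q * p / (Q - ε * p) →
          MemLp u (ENNReal.ofReal pstar) (μ.restrict B₀) ∧
          (⨍⁻ x in B₀, ‖u x‖ₑ ^ pstar ∂μ) ^ (1 / pstar) ≤
            ENNReal.ofReal (C * b ^ (-1 / p) * R₀ ^ (-Q / p)) *
              (ENNReal.ofReal (R₀ ^ s) * N
                + eLpNorm u (ENNReal.ofReal p) (μ.restrict σB₀)) ∧
          (⨅ γ : ℝ, (⨍⁻ x in B₀, ‖u x - γ‖ₑ ^ pstar ∂μ) ^ (1 / pstar)) ≤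
            ENNReal.ofReal (C * b ^ (-1 / p) * R₀ ^ (s - Q / p)) * N) ∧
        (p = Q / ε → 0 < N →
          IntegrableOn u B₀ μ ∧
          (⨍⁻ x in B₀, ENNReal.ofReal (Real.exp
              (C₁ * b ^ (1 / p) * (|u x - ⨍ y in B₀, u y ∂μ| / (R₀ ^ (s - ε) * N.toReal)))) ∂μ)
            ≤ ENNReal.ofReal C₂) ∧
        (Q / ε < p →
          IntegrableOn u B₀ μ ∧
          eLpNorm (fun x => u x - ⨍ y in B₀, u y ∂μ) ∞ (μ.restrict B₀) ≤
            ENNReal.ofReal (C * b ^ (-1 / p) * R₀ ^ (s - Q / p)) * N ∧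
          ∃ v : X → ℝ, v =ᵐ[μ.restrict B₀] u ∧
            ∀ x ∈ B₀, ∀ y ∈ B₀,
              |v x - v y| ≤ C * b ^ (-1 / p) * ρ x y ^ (s - Q / p) * N.toReal) := by
  obtain ⟨κ, hκ⟩ := hρ.exists_isQuasiBound
  have hκ0 : 0 < κ := one_pos.trans_le hκ.one_le
  have hη : (s + ε) / 2 < s := by linarith
  have hH := holderConst_pos (p := p) hκ0 hs hp hη
  have hS := sobolevConst_pos hκ0 hp hεs (show 0 < (s - ε) / 2 by linarith)
  set G : ℝ := embeddingConst κ s p ε with hG_def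
  have hHG : (κ ^ 2) ^ s * holderConst κ s p ((s + ε) / 2) ≤ G := by
    rw [hG_def, embeddingConst]
    have : 0 < (2 : ℝ) ^ (1 / p) * sobolevConst κ s p ε ((s - ε) / 2) := by positivity
    linarith
  have hG1 : 1 ≤ G := by
    rw [hG_def, embeddingConst]
    have h1 : 0 < (2 : ℝ) ^ (1 / p) * sobolevConst κ s p ε ((s - ε) / 2) := by positivity
    have h2 : 0 < (κ ^ 2) ^ s * holderConst κ s p ((s + ε) / 2) := by positivity
    linarith
  have hG0 : 0 < G := one_pos.trans_le hG1
  set c : ℝ := 2 * (2 ^ (1 / p)) ^ 2 with hc_def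
  have hc2 : 2 ≤ c := by
    have : (1 : ℝ) ≤ 2 ^ (1 / p) := Real.one_le_rpow one_le_two (by positivity)
    have := one_le_pow₀ this (n := 2)
    linarith
  have hc0 : 0 < c := by linarith
  have hGC : G ≤ c * G := le_mul_of_one_le_left hG0.le (by linarith)
  -- The factor `c` pays for the quasi-triangle inequality in (a) and for `M = 2N` in (c); the same
  -- doubling gives `2 * G` in (b).
  refine ⟨c * G, 1, Real.exp (2 * G), by positivity, one_pos, Real.exp_pos _, ?_⟩
  intro _ μ hμ q hq x₀ R₀ hR Q b hQ hb hV B₀ σB₀ hB₀ hσB₀ u hu N hN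
  have hNtop : N < ∞ := hN ▸ hu.2
  have hgrad : ∀ M : ℝ, N < ENNReal.ofReal M →
      ∃ g E, HasBoundedGradient ρ μ κ x₀ R₀ σ s p Q b M u g E := by
    intro M hM
    rw [hN, hσB₀] at hM
    obtain ⟨g, ⟨hgm, E, -, hE, hgE⟩, hgM⟩ := exists_fracGradient_of_besovSeminorm_lt hp hq hM
    exact ⟨g, E, hρ, hκ, hμ, hσ, hρ.one_le_quasiConst, hR, hs, hp, hQ, hb,
      ENNReal.ofReal_pos.1 (bot_le.trans_lt hM), hV, hgm, hgM, hE, hgE⟩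
  obtain ⟨M₁, hM₁⟩ : ∃ M : ℝ, N < ENNReal.ofReal M :=
    ⟨N.toReal + 1, (ENNReal.lt_ofReal_iff_toReal_lt hNtop.ne).2 (by linarith)⟩
  have hsub : B₀ ⊆ σB₀ := by
    obtain ⟨g, E, h⟩ := hgrad M₁ hM₁
    rw [hB₀, hσB₀]
    exact h.subset_dilate
  have huB : AEMeasurable u (μ.restrict B₀) := hu.1.mono_measure (Measure.restrict_mono hsub le_rfl)
  have hBnm : NullMeasurableSet B₀ μ := hB₀ ▸ hμ.nullMeasurable_ball x₀ R₀ hR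
  have hμ0 : μ B₀ ≠ 0 := hB₀ ▸ (hμ.ball_pos x₀ R₀ hR).ne'
  have hμt : μ B₀ ≠ ∞ := hB₀ ▸ (hμ.ball_lt_top x₀ R₀ hR).ne
  have hμb : ENNReal.ofReal (b * R₀ ^ Q) ≤ μ B₀ := by
    obtain ⟨g, E, h⟩ := hgrad M₁ hM₁
    rw [hB₀]
    exact h.ofReal_le_measure h.center_mem hR le_rfl
  have hosc : Q / p ≤ (s + ε) / 2 → ∀ M : ℝ, N < ENNReal.ofReal M →
      ∃ v : X → ℝ, v =ᵐ[μ.restrict B₀] u ∧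
      (∀ x ∈ B₀, ∀ y ∈ B₀, |v x - v y| ≤ G * b ^ (-1 / p) * ρ x y ^ (s - Q / p) * M) ∧
      IntegrableOn u B₀ μ ∧ ∀ᵐ x ∂μ.restrict B₀,
        |u x - ⨍ y in B₀, u y ∂μ| ≤ G * b ^ (-1 / p) * R₀ ^ (s - Q / p) * M := by
    intro hQp M hM
    obtain ⟨g, E, h⟩ := hgrad M hM
    obtain ⟨v, hvu, hv, hv'⟩ := h.exists_holder_of_le hη hQp hHG
    rw [← hB₀] at hvu hv hv'
    exact ⟨v, hvu, hv, integrableOn_and_ae_abs_sub_average_le hBnm hμ0 hμt huB hvu hv'⟩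
  -- The representative `v` depends on `M`, so no limit `M → N` is taken for it; `M = 2N` is fixed
  -- instead.
  have hdouble : 0 < N → N < ENNReal.ofReal (2 * N.toReal) := fun hN0 => by
    have := ENNReal.toReal_pos hN0.ne' hNtop.ne
    exact (ENNReal.lt_ofReal_iff_toReal_lt hNtop.ne).2 (by linarith)
  refine ⟨fun hpQ pstar hps => ?_, fun hpQ hN0 => ?_, fun hpQ => ?_⟩
  · have hεQ : ε * p < Q := by
      rw [lt_div_iff₀ hε] at hpQ
      linarith
    have hps0 : 0 < pstar := by
      rw [hps]
      exact div_pos (mul_pos hQ hp) (by linarith)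
    have hpps : p ≤ pstar := by
      rw [hps, le_div_iff₀ (by linarith)]
      nlinarith [mul_pos hε hp]
    have : Fact (μ B₀ < ∞) := ⟨hμt.lt_top⟩
    have hprob : IsProbabilityMeasure ((μ B₀)⁻¹ • μ.restrict B₀) := by
      refine ⟨?_⟩
      rw [Measure.smul_apply, Measure.restrict_apply_univ, smul_eq_mul,
        ENNReal.inv_mul_cancel hμ0 hμt]
    have hγ : ∀ M : ℝ, N < ENNReal.ofReal M → ∃ γ : ℝ,
        (⨍⁻ x in B₀, ‖u x - γ‖ₑ ^ pstar ∂μ) ^ (1 / pstar) ≤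
          ENNReal.ofReal (G * b ^ (-1 / p) * R₀ ^ (s - Q / p)) * ENNReal.ofReal M := by
      intro M hM
      obtain ⟨g, E, h⟩ := hgrad M hM
      rw [hB₀, ← ENNReal.ofReal_mul (by positivity)]
      exact h.exists_laverage_le_embeddingConst hε hεs hεQ hps
    refine ⟨?_, ?_, ?_⟩
    · obtain ⟨γ, h1⟩ := hγ M₁ hM₁
      rw [laverage_rpow_eq_eLpNorm μ B₀ hps0 (fun x => u x - γ)] at h1
      have h2 : MemLp (fun x => u x - γ) (ENNReal.ofReal pstar) ((μ B₀)⁻¹ • μ.restrict B₀) :=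
        ⟨((huB.sub_const γ).smul_measure _).aestronglyMeasurable, h1.trans_lt
          (ENNReal.mul_lt_top ENNReal.ofReal_lt_top ENNReal.ofReal_lt_top)⟩
      have h3 := h2.smul_measure hμt
      rw [smul_smul, ENNReal.mul_inv_cancel hμ0 hμt, one_smul] at h3
      simpa [Pi.add_def] using h3.add (memLp_const γ)
    · rw [mul_add, ← mul_assoc]
      refine le_mul_add_of_forall_lt_ofReal hNtop.ne
        (ENNReal.mul_lt_top ENNReal.ofReal_lt_top ENNReal.ofReal_lt_top).ne fun M hM => ?_
      obtain ⟨γ, h1⟩ := hγ M hM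
      rw [laverage_rpow_eq_eLpNorm μ B₀ hps0 (fun x => u x - γ)] at h1
      rw [laverage_rpow_eq_eLpNorm μ B₀ hps0 u]
      refine (eLpNorm_le_of_sub_const hp hpps (huB.smul_measure _).aestronglyMeasurable γ).trans ?_
      rw [mul_add, ← hc_def]
      refine add_le_add ?_ ?_
      · refine (mul_le_mul_right h1 _).trans_eq ?_
        rw [← mul_assoc, ← ENNReal.ofReal_mul hc0.le,
          ← ENNReal.ofReal_mul (p := c * G * b ^ (-1 / p) * R₀ ^ (-Q / p)) (by positivity)]
        have : R₀ ^ (s - Q / p) = R₀ ^ (-Q / p) * R₀ ^ s := by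
          rw [← Real.rpow_add hR]
          congr 1
          ring
        rw [this]
        congr 2
        ring
      · refine (mul_le_mul_right (eLpNorm_normalized_le hsub hb hR hp hμb u) _).trans ?_
        rw [← mul_assoc, ← ENNReal.ofReal_mul (by positivity)]
        refine mul_le_mul_left (ENNReal.ofReal_le_ofReal ?_) _
        rw [← mul_assoc]
        gcongr
        exact le_mul_of_one_le_right hc0.le hG1
    · have := le_mul_add_of_forall_lt_ofReal (d := 0) hNtop.ne ENNReal.ofReal_ne_top
        (a := ⨅ γ : ℝ, (⨍⁻ x in B₀, ‖u x - γ‖ₑ ^ pstar ∂μ) ^ (1 / pstar)) fun M hM => by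
          obtain ⟨γ, h1⟩ := hγ M hM
          rw [add_zero]
          exact (iInf_le _ γ).trans h1
      rw [add_zero] at this
      refine this.trans (mul_le_mul_left (ENNReal.ofReal_le_ofReal ?_) _)
      gcongr
  · have hQp : Q / p = ε := by
      rw [hpQ]
      field_simp
    have hNpos := ENNReal.toReal_pos hN0.ne' hNtop.ne
    obtain ⟨v, -, -, hint, hae⟩ := hosc (by linarith) _ (hdouble hN0)
    refine ⟨hint, ?_⟩
    rw [setLAverage_eq]
    refine ENNReal.div_le_of_le_mul ?_
    rw [← setLIntegral_const]
    refine lintegral_mono_ae ?_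
    filter_upwards [hae] with x hx
    refine ENNReal.ofReal_le_ofReal (Real.exp_le_exp.2 ?_)
    rw [hQp] at hx
    have hbb : b ^ (1 / p) * b ^ (-1 / p) = 1 := by
      rw [← Real.rpow_add hb, ← add_div]
      simp
    calc 1 * b ^ (1 / p) * (|u x - ⨍ y in B₀, u y ∂μ| / (R₀ ^ (s - ε) * N.toReal))
        ≤ 1 * b ^ (1 / p) * (G * b ^ (-1 / p) * R₀ ^ (s - ε) * (2 * N.toReal) /
          (R₀ ^ (s - ε) * N.toReal)) := by gcongr
      _ = (b ^ (1 / p) * b ^ (-1 / p)) * (2 * G) := by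
          have : R₀ ^ (s - ε) ≠ 0 := by positivity
          field_simp
      _ = 2 * G := by rw [hbb, one_mul]
  · have hQp : Q / p ≤ (s + ε) / 2 := by
      rw [div_lt_iff₀ hε] at hpQ
      rw [div_le_iff₀ hp]
      nlinarith
    have hsup : eLpNorm (fun x => u x - ⨍ y in B₀, u y ∂μ) ∞ (μ.restrict B₀) ≤
        ENNReal.ofReal (c * G * b ^ (-1 / p) * R₀ ^ (s - Q / p)) * N := by
      have := le_mul_add_of_forall_lt_ofReal (d := 0) hNtop.ne
        (ENNReal.ofReal_ne_top (r := c * G * b ^ (-1 / p) * R₀ ^ (s - Q / p)))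
        (a := eLpNorm (fun x => u x - ⨍ y in B₀, u y ∂μ) ∞ (μ.restrict B₀)) fun M hM => by
          obtain ⟨v, -, -, -, hae⟩ := hosc hQp M hM
          have hM0 : 0 < M := ENNReal.ofReal_pos.1 (bot_le.trans_lt hM)
          rw [add_zero, eLpNorm_exponent_top, ← ENNReal.ofReal_mul (by positivity)]
          refine eLpNormEssSup_le_of_ae_bound ?_
          filter_upwards [hae] with x hx
          refine hx.trans ?_
          gcongr
      rwa [add_zero] at this
    refine ⟨(hosc hQp M₁ hM₁).choose_spec.2.2.1, hsup, ?_⟩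
    -- For `N = 0` doubling gives no admissible `M`, but the sup bound already makes `u` almost
    -- everywhere constant.
    rcases eq_zero_or_pos N with hN0 | hN0
    · rw [hN0, mul_zero, nonpos_iff_eq_zero, eLpNorm_eq_zero_iff
        ((huB.sub_const _).aestronglyMeasurable) ENNReal.top_ne_zero] at hsup
      refine ⟨fun _ => ⨍ y in B₀, u y ∂μ, ?_, fun x _ y _ => by simp [hN0]⟩
      filter_upwards [hsup] with x hx
      exact (sub_eq_zero.1 hx).symm
    · obtain ⟨v, hvu, hv, -⟩ := hosc hQp _ (hdouble hN0)
      refine ⟨v, hvu, fun x hx y hy => (hv x hx y hy).trans ?_⟩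
      have := hρ.nonneg x y
      calc G * b ^ (-1 / p) * ρ x y ^ (s - Q / p) * (2 * N.toReal)
          = 2 * G * b ^ (-1 / p) * ρ x y ^ (s - Q / p) * N.toReal := by ring
        _ ≤ _ := by gcongr
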